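/- Let $G$ be a finite group, let $\alpha\colon G\times G\to S^1$ be a normalized 2-cocycle ($\alpha(1,1)=1$, trivial action on $S^1$) representing a class in $H^2(G,S^1)$, and let $\widetilde G_\alpha=G\times S^1$ with $(g,a)(h,b)=(gh,\alpha(g,h)ab)$ be the corresponding central extension of $G$ by $S^1$. An $\alpha$-representation is a finite-dimensional complex vector space $V$ with $\rho\colon G\to GL(V)$ such that $\rho(1)=1$ and $\rho(g)\rho(h)=\alpha(g,h)\rho(gh)$; equivalently $\widetilde G_\alpha$ acts on $V$ by $(g,a)\mapsto a\rho(g)$. Let $R_\alpha(G)$ be the Grothendieck group of isomorphism classes of $\alpha$-representations. For a $G$-space $X$, an $\alpha$-twisted $G$-vector bundle on $X$ is a complex vector bundle $E\to X$ (finite, locally constant rank) with a continuous, fibrewise linear action of $\widetilde G_\alpha$ covering the $G$-action on $X$, in which the central $S^1$ acts by complex multiplication; ${}^\alpha K_G(X)$ is the Grothendieck group of isomorphism classes of such bundles, and $K(X)$ is the Grothendieck group of isomorphism classes of complex vector bundles on $X$. Let $X$ be a topological space (for instance a CW-complex) with trivial $G$-action. Then the homomorphism $$\Phi_X\colon K(X)\otimes_{\mathbb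 Z} R_\alpha(G)\longrightarrow {}^\alpha K_G(X),\qquad [E]\otimes[M]\longmapsto[E\otimes M],$$ where $E$ carries the trivial action and $(g,a)\in\widetilde G_\alpha$ acts on $E\otimes M$ by $\mathrm{id}\otimes a\rho(g)$, is an isomorphism. There are finitely many irreducible $\alpha$-representations up to isomorphism, and if $M_1,\dots,M_n$ lists each of them exactly once, then the inverse is $$\Phi_X^{-1}[E]=\sum_{i=1}^n\,[\mathrm{Hom}_{\widetilde G_\alpha}(M_i,E)]\otimes[M_i]$$ for every $\alpha$-twisted bundle $E$, where $\mathrm{Hom}_{\widetilde G_\alpha}(M_i,E)$ is the vector bundle on $X$ with fibres $\mathrm{Hom}_{\widetilde G_\alpha}(M_i,E_x)$. The isomorphism is natural: for a homomorphism $h\colon H\to G$ of finite groups, a space $Y$ with trivial $H$-action and a continuous map $f\colon Y\to X$, one has $\Phi_Y\circ(f^*\otimes h^*)=(h,f)^*\circ\Phi_X$ as maps $K(X)\otimes R_\alpha(G)\to{}^{h^*\alpha}K_H(Y)$. -/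

import Mathlib

open scoped TensorProduct

namespace TwistedK

universe u v w

/-! ### Complex vector bundles (the rank may vary over the base) -/

/-- The total space of a family of sets `E x`, `x ∈ X`. -/
structure Tot {X : Type u} (E : X → Type) : Type u where
  base : X
  vec : E base

section LocalTriv

variable {X : Type u} [TopologicalSpace X]

/-- A linear trivialization over `U` with typical fibre `W`: a homeomorphism, over `U` and linear on
the fibres, between the part of the total space over `U` and `U × W`. -/
structure LocalTriv (E : X → Type) [∀ x, AddCommGroup (E x)] [∀ x, Module ℂ (E x)]
    [TopologicalSpace (Tot E)] (U : Set X) (W : Type) [AddCommGroup W] [Module ℂ W]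
    [TopologicalSpace W] where
  chart : ∀ x : U, E x ≃ₗ[ℂ] W
  continuous_chart :
    Continuous fun e : {e : Tot E // e.base ∈ U} => chart ⟨e.1.base, e.2⟩ e.1.vec
  continuous_symm :
    Continuous fun q : U × W => (⟨q.1, (chart q.1).symm q.2⟩ : Tot E)

/-- A complex vector bundle over `X`: finite-dimensional complex vector spaces `fiber x`, with a
topology on their total space for which the projection is continuous and which is locally
isomorphic to `U × ℂⁿ`. The rank `n` is only locally constant. -/
structure CBundle (X : Type u) [TopologicalSpace X] where
  fiber : X → Type
  [acg : ∀ x, AddCommGroup (fiber x)]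
  [mod : ∀ x, Module ℂ (fiber x)]
  [top : TopologicalSpace (Tot fiber)]
  continuous_base : Continuous (Tot.base : Tot fiber → X)
  locally_trivial : ∀ x₀ : X, ∃ (U : Set X) (n : ℕ), IsOpen U ∧ x₀ ∈ U ∧
    Nonempty (LocalTriv fiber U (Fin n → ℂ))

attribute [instance] CBundle.acg CBundle.mod CBundle.top

variable {E : X → Type} [∀ x, AddCommGroup (E x)] [∀ x, Module ℂ (E x)] [TopologicalSpace (Tot E)]

theorem LocalTriv.continuous_coord {U : Set X} {W : Type} [AddCommGroup W] [Module ℂ W]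
    [TopologicalSpace W] (T : LocalTriv E U W) {Z : Type*} [TopologicalSpace Z] {F : Z → Tot E}
    (hF : Continuous F) (h : ∀ z, (F z).base ∈ U) :
    Continuous fun z => T.chart ⟨(F z).base, h z⟩ (F z).vec :=
  T.continuous_chart.comp (hF.subtype_mk h)

/-- Trivializations restrict to smaller sets. -/
def LocalTriv.restrict {U U' : Set X} {W : Type} [AddCommGroup W] [Module ℂ W]
    [TopologicalSpace W] (T : LocalTriv E U W) (h : U' ⊆ U) : LocalTriv E U' W where
  chart x := T.chart ⟨x, h x.2⟩
  continuous_chart :=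
    T.continuous_coord (F := fun e : {e : Tot E // e.base ∈ U'} => e.1) continuous_subtype_val
      (fun e => h e.2)
  continuous_symm := by
    have := T.continuous_symm.comp
      (f := fun q : U' × W => ((⟨q.1, h q.1.2⟩ : U), q.2)) (by fun_prop)
    exact this

/-- The typical fibre may be changed along a linear homeomorphism. -/
def LocalTriv.changeModel {U : Set X} {W W' : Type} [AddCommGroup W] [Module ℂ W]
    [TopologicalSpace W] [AddCommGroup W'] [Module ℂ W'] [TopologicalSpace W']
    (T : LocalTriv E U W) (L : W ≃L[ℂ] W') : LocalTriv E U W' where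
  chart x := (T.chart x).trans L.toLinearEquiv
  continuous_chart := L.continuous.comp T.continuous_chart
  continuous_symm := by
    have := T.continuous_symm.comp
      (f := fun q : U × W' => (q.1, L.symm q.2)) (by fun_prop)
    exact this

theorem LocalTriv.exists_standard {U : Set X} {W : Type} [NormedAddCommGroup W]
    [NormedSpace ℂ W] [FiniteDimensional ℂ W] (T : LocalTriv E U W) :
    ∃ n : ℕ, Nonempty (LocalTriv E U (Fin n → ℂ)) :=
  ⟨Module.finrank ℂ W, ⟨T.changeModel
    (Module.finBasis ℂ W).equivFun.toContinuousLinearEquiv⟩⟩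

end LocalTriv

namespace CBundle

section Continuity

variable {X : Type u} [TopologicalSpace X] (E : CBundle X)

theorem continuous_of_local {Z : Type*} [TopologicalSpace Z] {Y : Type*} [TopologicalSpace Y]
    {f : Z → X} (hf : Continuous f) (F : Z → Y)
    (h : ∀ x₀ : X, ∃ U : Set X, IsOpen U ∧ x₀ ∈ U ∧ Continuous fun z : {z : Z // f z ∈ U} => F z) :
    Continuous F := by
  rw [continuous_iff_continuousAt]
  intro z₀
  obtain ⟨U, hU, hz, hc⟩ := h (f z₀)
  have : ContinuousOn F {z : Z | f z ∈ U} := continuousOn_iff_continuous_domRestrict.2 hc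
  exact this.continuousAt ((hU.preimage hf).mem_nhds hz)

theorem continuous_zero : Continuous fun x : X => (⟨x, 0⟩ : Tot E.fiber) := by
  refine continuous_of_local continuous_id _ fun x₀ => ?_
  obtain ⟨U, n, hU, hx, ⟨T⟩⟩ := E.locally_trivial x₀
  refine ⟨U, hU, hx, ?_⟩
  have := T.continuous_symm.comp (f := fun x : U => (x, (0 : Fin n → ℂ))) (by fun_prop)
  simpa [Function.comp_def] using this

/-- Fibrewise linear combinations with continuous coefficients are continuous. -/
theorem continuous_smul_add {Z : Type*} [TopologicalSpace Z] {f : Z → X} {c : Z → ℂ}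
    (hc : Continuous c) {s t : ∀ z, E.fiber (f z)}
    (hs : Continuous fun z => (⟨f z, s z⟩ : Tot E.fiber))
    (ht : Continuous fun z => (⟨f z, t z⟩ : Tot E.fiber)) :
    Continuous fun z => (⟨f z, c z • s z + t z⟩ : Tot E.fiber) := by
  have hf : Continuous f := E.continuous_base.comp hs
  refine continuous_of_local hf _ fun x₀ => ?_
  obtain ⟨U, n, hU, hx, ⟨T⟩⟩ := E.locally_trivial x₀
  refine ⟨U, hU, hx, ?_⟩
  have h1 := T.continuous_coord (hs.comp continuous_subtype_val)
    (fun z : {z : Z // f z ∈ U} => z.2)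
  have h2 := T.continuous_coord (ht.comp continuous_subtype_val)
    (fun z : {z : Z // f z ∈ U} => z.2)
  have hc' : Continuous fun z : {z : Z // f z ∈ U} => c z := hc.comp continuous_subtype_val
  have hb : Continuous fun z : {z : Z // f z ∈ U} => (⟨f z, z.2⟩ : U) :=
    (hf.comp continuous_subtype_val).subtype_mk _
  have := T.continuous_symm.comp (hb.prodMk ((hc'.smul h1).add h2))
  simpa [Function.comp_def] using this

theorem continuous_add {Z : Type*} [TopologicalSpace Z] {f : Z → X} {s t : ∀ z, E.fiber (f z)}
    (hs : Continuous fun z => (⟨f z, s z⟩ : Tot E.fiber))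
    (ht : Continuous fun z => (⟨f z, t z⟩ : Tot E.fiber)) :
    Continuous fun z => (⟨f z, s z + t z⟩ : Tot E.fiber) := by
  simpa using E.continuous_smul_add (c := fun _ => 1) continuous_const hs ht

theorem continuous_smul {Z : Type*} [TopologicalSpace Z] {f : Z → X} {c : Z → ℂ}
    (hc : Continuous c) {s : ∀ z, E.fiber (f z)}
    (hs : Continuous fun z => (⟨f z, s z⟩ : Tot E.fiber)) :
    Continuous fun z => (⟨f z, c z • s z⟩ : Tot E.fiber) := by
  simpa using E.continuous_smul_add hc hs
    (t := fun _ => 0) (E.continuous_zero.comp (E.continuous_base.comp hs))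

theorem finiteDimensional_fiber (x : X) : FiniteDimensional ℂ (E.fiber x) := by
  obtain ⟨U, n, hU, hx, ⟨T⟩⟩ := E.locally_trivial x
  exact (T.chart ⟨x, hx⟩).symm.finiteDimensional

end Continuity

/-! ### Isomorphisms -/

variable {X : Type u} [TopologicalSpace X]

/-- An isomorphism of vector bundles over `X`. -/
structure Iso (E E' : CBundle X) where
  toEquiv : ∀ x, E.fiber x ≃ₗ[ℂ] E'.fiber x
  continuous_toFun :
    Continuous fun e : Tot E.fiber => (⟨e.base, toEquiv e.base e.vec⟩ : Tot E'.fiber)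
  continuous_invFun :
    Continuous fun e : Tot E'.fiber => (⟨e.base, (toEquiv e.base).symm e.vec⟩ : Tot E.fiber)

namespace Iso

def refl (E : CBundle X) : Iso E E where
  toEquiv _ := LinearEquiv.refl ℂ _
  continuous_toFun := continuous_id
  continuous_invFun := continuous_id

def symm {E E' : CBundle X} (φ : Iso E E') : Iso E' E where
  toEquiv x := (φ.toEquiv x).symm
  continuous_toFun := φ.continuous_invFun
  continuous_invFun := φ.continuous_toFun

def trans {E E' E'' : CBundle X} (φ : Iso E E') (ψ : Iso E' E'') : Iso E E'' where
  toEquiv x := (φ.toEquiv x).trans (ψ.toEquiv x)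
  continuous_toFun := ψ.continuous_toFun.comp φ.continuous_toFun
  continuous_invFun := φ.continuous_invFun.comp ψ.continuous_invFun

theorem continuous_map {E E' : CBundle X} (φ : Iso E E') {Z : Type*} [TopologicalSpace Z]
    {f : Z → X} {s : ∀ z, E.fiber (f z)} (hs : Continuous fun z => (⟨f z, s z⟩ : Tot E.fiber)) :
    Continuous fun z => (⟨f z, φ.toEquiv (f z) (s z)⟩ : Tot E'.fiber) :=
  φ.continuous_toFun.comp hs

end Iso

/-! ### Zero bundle, direct sums, pullbacks -/

/-- The zero bundle. -/
def zero (X : Type u) [TopologicalSpace X] : CBundle X where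
  fiber _ := Unit
  top := TopologicalSpace.induced Tot.base inferInstance
  continuous_base := continuous_induced_dom
  locally_trivial x₀ := by
    let _ : TopologicalSpace (Tot fun _ : X => Unit) :=
      TopologicalSpace.induced Tot.base inferInstance
    refine ⟨Set.univ, 0, isOpen_univ, trivial, ⟨{
      chart := fun _ => LinearEquiv.ofLinearMap 0 0 (by ext x i; exact i.elim0) (by ext)
      continuous_chart := by
        exact continuous_const
      continuous_symm := continuous_induced_rng.2 ?_ }⟩⟩
    exact continuous_subtype_val.comp continuous_fst

section Sum

variable (E E' : CBundle X)

/-- The topology of the fibre product over `X`. -/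
abbrev sumTop : TopologicalSpace (Tot fun x => E.fiber x × E'.fiber x) :=
  TopologicalSpace.induced
    (fun e => ((⟨e.base, e.vec.1⟩ : Tot E.fiber), (⟨e.base, e.vec.2⟩ : Tot E'.fiber))) inferInstance

attribute [local instance] sumTop

theorem continuous_sum_iff {Z : Type*} [TopologicalSpace Z]
    {F : Z → Tot fun x => E.fiber x × E'.fiber x} :
    Continuous F ↔ (Continuous fun z => (⟨(F z).base, (F z).vec.1⟩ : Tot E.fiber)) ∧
      Continuous fun z => (⟨(F z).base, (F z).vec.2⟩ : Tot E'.fiber) := by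
  rw [continuous_induced_rng]
  exact continuous_prodMk

/-- The direct sum of two vector bundles. -/
def sum : CBundle X where
  fiber x := E.fiber x × E'.fiber x
  continuous_base :=
    E.continuous_base.comp ((continuous_sum_iff E E').1 continuous_id).1
  locally_trivial x₀ := by
    obtain ⟨U, n, hU, hx, ⟨T⟩⟩ := E.locally_trivial x₀
    obtain ⟨U', n', hU', hx', ⟨T'⟩⟩ := E'.locally_trivial x₀
    have S := T.restrict (U' := U ∩ U') Set.inter_subset_left
    have S' := T'.restrict (U' := U ∩ U') Set.inter_subset_right
    have hc := (continuous_sum_iff E E').1 continuous_id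
    let R : LocalTriv (fun x => E.fiber x × E'.fiber x) (U ∩ U')
        ((Fin n → ℂ) × (Fin n' → ℂ)) :=
      { chart := fun x => (S.chart x).prodCongr (S'.chart x)
        continuous_chart :=
          (S.continuous_coord (hc.1.comp continuous_subtype_val) (fun e => e.2)).prodMk
          (S'.continuous_coord (hc.2.comp continuous_subtype_val) (fun e => e.2))
        continuous_symm := by
          refine (continuous_sum_iff E E').2 ⟨?_, ?_⟩
          · exact S.continuous_symm.comp
              (f := fun q : ↑(U ∩ U') × ((Fin n → ℂ) × (Fin n' → ℂ)) => (q.1, q.2.1)) (by fun_prop)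
          · exact S'.continuous_symm.comp
              (f := fun q : ↑(U ∩ U') × ((Fin n → ℂ) × (Fin n' → ℂ)) => (q.1, q.2.2)) (by fun_prop) }
    obtain ⟨m, hm⟩ := R.exists_standard
    exact ⟨U ∩ U', m, hU.inter hU', ⟨hx, hx'⟩, hm⟩

variable {E E'}

theorem continuous_sum_fst {Z : Type*} [TopologicalSpace Z] {f : Z → X}
    {s : ∀ z, (E.sum E').fiber (f z)} (hs : Continuous fun z => (⟨f z, s z⟩ : Tot (E.sum E').fiber)) :
    Continuous fun z => (⟨f z, (s z).1⟩ : Tot E.fiber) :=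
  ((continuous_sum_iff E E').1 hs).1

theorem continuous_sum_snd {Z : Type*} [TopologicalSpace Z] {f : Z → X}
    {s : ∀ z, (E.sum E').fiber (f z)} (hs : Continuous fun z => (⟨f z, s z⟩ : Tot (E.sum E').fiber)) :
    Continuous fun z => (⟨f z, (s z).2⟩ : Tot E'.fiber) :=
  ((continuous_sum_iff E E').1 hs).2

theorem continuous_sum_mk {Z : Type*} [TopologicalSpace Z] {f : Z → X}
    {s : ∀ z, E.fiber (f z)} {t : ∀ z, E'.fiber (f z)}
    (hs : Continuous fun z => (⟨f z, s z⟩ : Tot E.fiber))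
    (ht : Continuous fun z => (⟨f z, t z⟩ : Tot E'.fiber)) :
    Continuous fun z => (⟨f z, (s z, t z)⟩ : Tot (E.sum E').fiber) :=
  (continuous_sum_iff E E').2 ⟨hs, ht⟩

end Sum

namespace Iso

def sumCongr {E₁ E₂ E₁' E₂' : CBundle X} (φ : Iso E₁ E₁') (ψ : Iso E₂ E₂') :
    Iso (E₁.sum E₂) (E₁'.sum E₂') where
  toEquiv x := (φ.toEquiv x).prodCongr (ψ.toEquiv x)
  continuous_toFun := continuous_sum_mk
    (φ.continuous_map (continuous_sum_fst continuous_id))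
    (ψ.continuous_map (continuous_sum_snd continuous_id))
  continuous_invFun := continuous_sum_mk
    (φ.symm.continuous_map (continuous_sum_fst continuous_id))
    (ψ.symm.continuous_map (continuous_sum_snd continuous_id))

def sumComm (E E' : CBundle X) : Iso (E.sum E') (E'.sum E) where
  toEquiv _ := LinearEquiv.prodComm ℂ _ _
  continuous_toFun := continuous_sum_mk
    (continuous_sum_snd continuous_id) (continuous_sum_fst continuous_id)
  continuous_invFun := continuous_sum_mk
    (continuous_sum_snd continuous_id) (continuous_sum_fst continuous_id)

def sumAssoc (E E' E'' : CBundle X) : Iso ((E.sum E').sum E'') (E.sum (E'.sum E'')) where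
  toEquiv _ := LinearEquiv.prodAssoc ℂ _ _ _
  continuous_toFun := continuous_sum_mk (E := E) (E' := E'.sum E'')
    (continuous_sum_fst (continuous_sum_fst continuous_id))
    (continuous_sum_mk (continuous_sum_snd (continuous_sum_fst continuous_id))
      (continuous_sum_snd continuous_id))
  continuous_invFun := continuous_sum_mk (E := E.sum E')
    (continuous_sum_mk (continuous_sum_fst continuous_id)
      (continuous_sum_fst (continuous_sum_snd continuous_id)))
    (continuous_sum_snd (continuous_sum_snd continuous_id))

def zeroSum (E : CBundle X) : Iso ((zero X).sum E) E where
  toEquiv x := LinearEquiv.prodUnique (R := ℂ) (M := E.fiber x) (M₂ := Unit) |>.symm.trans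
    (LinearEquiv.prodComm ℂ _ _) |>.symm
  continuous_toFun := continuous_sum_snd continuous_id
  continuous_invFun := continuous_sum_mk (E := zero X)
    ((zero X).continuous_zero.comp E.continuous_base) continuous_id

end Iso

section Pullback

variable {Y : Type v} [TopologicalSpace Y] (E : CBundle X) (f : C(Y, X))

/-- The topology of the fibre product `Y ×_X E`. -/
abbrev pullbackTop : TopologicalSpace (Tot fun y : Y => E.fiber (f y)) :=
  TopologicalSpace.induced
    (fun e => (e.base, (⟨f e.base, e.vec⟩ : Tot E.fiber))) inferInstance

attribute [local instance] pullbackTop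

theorem continuous_pullback_iff' {Z : Type*} [TopologicalSpace Z]
    {F : Z → Tot fun y : Y => E.fiber (f y)} :
    Continuous F ↔ (Continuous fun z => (F z).base) ∧
      Continuous fun z => (⟨f (F z).base, (F z).vec⟩ : Tot E.fiber) := by
  rw [continuous_induced_rng]
  exact continuous_prodMk

/-- The pullback of a vector bundle along a continuous map. -/
def pullback : CBundle Y where
  fiber y := E.fiber (f y)
  continuous_base := ((continuous_pullback_iff' E f).1 continuous_id).1
  locally_trivial y₀ := by
    obtain ⟨U, n, hU, hx, ⟨T⟩⟩ := E.locally_trivial (f y₀)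
    refine ⟨f ⁻¹' U, n, hU.preimage f.continuous, hx, ⟨{
      chart := fun y => T.chart ⟨f y, y.2⟩
      continuous_chart := T.continuous_coord
        (((continuous_pullback_iff' E f).1 continuous_id).2.comp continuous_subtype_val)
        (fun e => e.2)
      continuous_symm := (continuous_pullback_iff' E f).2 ⟨by fun_prop, ?_⟩ }⟩⟩
    exact T.continuous_symm.comp
      (f := fun q : ↑(f ⁻¹' U) × (Fin n → ℂ) => ((⟨f q.1, q.1.2⟩ : U), q.2)) (by fun_prop)

theorem continuous_pullback_iff {Z : Type*} [TopologicalSpace Z] {F : Z → Tot (E.pullback f).fiber} :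
    Continuous F ↔ (Continuous fun z => (F z).base) ∧
      Continuous fun z => (⟨f (F z).base, (F z).vec⟩ : Tot E.fiber) :=
  continuous_pullback_iff' E f

end Pullback

namespace Iso

variable {Y : Type v} [TopologicalSpace Y] (f : C(Y, X))

def pullback {E E' : CBundle X} (φ : Iso E E') : Iso (E.pullback f) (E'.pullback f) where
  toEquiv y := φ.toEquiv (f y)
  continuous_toFun := by
    have h := (continuous_pullback_iff E f).1 continuous_id
    exact (continuous_pullback_iff E' f).2 ⟨h.1, φ.continuous_map h.2⟩
  continuous_invFun := by
    have h := (continuous_pullback_iff E' f).1 continuous_id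
    exact (continuous_pullback_iff E f).2 ⟨h.1, φ.symm.continuous_map h.2⟩

def pullbackSum (E E' : CBundle X) :
    Iso ((E.sum E').pullback f) ((E.pullback f).sum (E'.pullback f)) where
  toEquiv _ := LinearEquiv.refl ℂ _
  continuous_toFun := by
    have h := (continuous_pullback_iff (E.sum E') f).1 continuous_id
    exact continuous_sum_mk (E := E.pullback f) (E' := E'.pullback f)
      (f := fun e : Tot ((E.sum E').pullback f).fiber => e.base)
      (s := fun e => e.vec.1) (t := fun e => e.vec.2)
      ((continuous_pullback_iff E f).2 ⟨h.1, continuous_sum_fst h.2⟩)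
      ((continuous_pullback_iff E' f).2 ⟨h.1, continuous_sum_snd h.2⟩)
  continuous_invFun := by
    have h := (continuous_sum_iff (E.pullback f) (E'.pullback f)).1
      (continuous_id (X := Tot ((E.pullback f).sum (E'.pullback f)).fiber))
    exact (continuous_pullback_iff (E.sum E') f).2
      ⟨((continuous_pullback_iff E f).1 h.1).1,
        continuous_sum_mk ((continuous_pullback_iff E f).1 h.1).2
          ((continuous_pullback_iff E' f).1 h.2).2⟩

def pullbackZero : Iso ((zero X).pullback f) (zero Y) where
  toEquiv _ := LinearEquiv.refl ℂ _
  continuous_toFun := continuous_induced_rng.2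
    ((continuous_pullback_iff (zero X) f).1 continuous_id).1
  continuous_invFun := (continuous_pullback_iff (zero X) f).2
    ⟨continuous_induced_dom, (zero X).continuous_zero.comp (f.continuous.comp
      continuous_induced_dom)⟩

end Iso

end CBundle

namespace CBundle

variable {X : Type u} [TopologicalSpace X]

/-! ### Tensor product with a fixed finite-dimensional vector space -/

section Tensor

variable (E : CBundle X) (V : Type) [AddCommGroup V] [Module ℂ V]

/-- Contraction `F ⊗ V → F` with a linear form on `V`. -/
noncomputable def contr (F : Type) [AddCommGroup F] [Module ℂ F] {V : Type} [AddCommGroup V]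
    [Module ℂ V] (θ : Module.Dual ℂ V) : F ⊗[ℂ] V →ₗ[ℂ] F :=
  (TensorProduct.rid ℂ F).toLinearMap ∘ₗ θ.lTensor F

@[simp]
theorem contr_tmul {F : Type} [AddCommGroup F] [Module ℂ F] {V : Type} [AddCommGroup V]
    [Module ℂ V] (θ : Module.Dual ℂ V) (e : F) (v : V) :
    contr F θ (e ⊗ₜ[ℂ] v) = θ v • e := by
  simp [contr]

/-- The topology of `E ⊗ V`: the coarsest one for which the projection and all contractions
`E ⊗ V → E` with linear forms on `V` are continuous. -/
noncomputable abbrev tensorTop : TopologicalSpace (Tot fun x => E.fiber x ⊗[ℂ] V) :=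
  TopologicalSpace.induced
    (fun e => (e.base, fun θ : Module.Dual ℂ V =>
      (⟨e.base, contr (E.fiber e.base) θ e.vec⟩ : Tot E.fiber))) inferInstance

attribute [local instance] tensorTop

theorem continuous_tensor_iff' {Z : Type*} [TopologicalSpace Z]
    {F : Z → Tot fun x => E.fiber x ⊗[ℂ] V} :
    Continuous F ↔ (Continuous fun z => (F z).base) ∧ ∀ θ : Module.Dual ℂ V,
      Continuous fun z => (⟨(F z).base, contr _ θ (F z).vec⟩ : Tot E.fiber) := by
  rw [continuous_induced_rng]
  exact continuous_prodMk.trans (and_congr Iff.rfl continuous_pi_iff)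

/-- The vector bundle `E ⊗ V`, where `V` is a finite-dimensional vector space. -/
noncomputable def tensor [FiniteDimensional ℂ V] : CBundle X where
  fiber x := E.fiber x ⊗[ℂ] V
  continuous_base := ((continuous_tensor_iff' E V).1 continuous_id).1
  locally_trivial x₀ := by
    obtain ⟨U, n, hU, hx, ⟨T⟩⟩ := E.locally_trivial x₀
    let b := Module.finBasis ℂ V
    let ch : ∀ x : U, E.fiber x ⊗[ℂ] V ≃ₗ[ℂ] (Fin (Module.finrank ℂ V) → Fin n → ℂ) := fun x =>
      (TensorProduct.congr (T.chart x) b.equivFun).trans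
        (TensorProduct.piScalarRight ℂ ℂ (Fin n → ℂ) (Fin (Module.finrank ℂ V)))
    have h1 : ∀ (x : U) t j, ch x t j = T.chart x (contr _ (b.coord j) t) := by
      intro x t j
      induction t using TensorProduct.induction_on with
      | zero => simp
      | tmul e v => simp [ch]
      | add s t hs ht => simp [hs, ht]
    have h2 : ∀ (x : U) (θ : Module.Dual ℂ V) t,
        contr _ θ t = (T.chart x).symm (∑ j, θ (b j) • ch x t j) := by
      intro x θ t
      rw [LinearEquiv.eq_symm_apply]
      induction t using TensorProduct.induction_on with
      | zero => simp
      | tmul e v =>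
        conv_lhs => rw [contr_tmul, ← b.sum_repr v]
        simp only [h1, contr_tmul, map_sum, map_smul, smul_eq_mul, Finset.sum_smul]
        exact Finset.sum_congr rfl fun j _ => by
          rw [smul_smul, mul_comm]; rfl
      | add s t hs ht => simp [hs, ht, Finset.sum_add_distrib, smul_add]
    have hc := (continuous_tensor_iff' E V).1 continuous_id
    let R : LocalTriv (fun x => E.fiber x ⊗[ℂ] V) U (Fin (Module.finrank ℂ V) → Fin n → ℂ) :=
      { chart := ch
        continuous_chart := by
          refine continuous_pi fun j => ?_
          simp only [h1]
          exact T.continuous_coord ((hc.2 (b.coord j)).comp continuous_subtype_val) (fun e => e.2)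
        continuous_symm := by
          refine (continuous_tensor_iff' E V).2 ⟨by fun_prop, fun θ => ?_⟩
          simp only [h2 _ θ, LinearEquiv.apply_symm_apply]
          exact T.continuous_symm.comp
            (f := fun q : U × (Fin (Module.finrank ℂ V) → Fin n → ℂ) =>
              (q.1, ∑ j, θ (b j) • q.2 j)) (by fun_prop) }
    obtain ⟨m, hm⟩ := R.exists_standard
    exact ⟨U, m, hU, hx, hm⟩

theorem continuous_tensor_iff [FiniteDimensional ℂ V] {Z : Type*} [TopologicalSpace Z]
    {F : Z → Tot (E.tensor V).fiber} :
    Continuous F ↔ (Continuous fun z => (F z).base) ∧ ∀ θ : Module.Dual ℂ V,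
      Continuous fun z => (⟨(F z).base, contr _ θ (F z).vec⟩ : Tot E.fiber) :=
  continuous_tensor_iff' E V

end Tensor

/-- The identification of fibres over equal points. -/
def castFiber (E : CBundle X) : {x y : X} → x = y → (E.fiber x ≃ₗ[ℂ] E.fiber y)
  | _, _, rfl => LinearEquiv.refl ℂ _

@[simp]
theorem castFiber_rfl (E : CBundle X) {x : X} (v : E.fiber x) : E.castFiber rfl v = v := rfl

theorem mk_castFiber (E : CBundle X) {x y : X} (h : x = y) (v : E.fiber x) :
    (⟨y, E.castFiber h v⟩ : Tot E.fiber) = ⟨x, v⟩ := by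
  subst h; rfl

theorem mk_inj (E : CBundle X) {x : X} {v w : E.fiber x}
    (h : (⟨x, v⟩ : Tot E.fiber) = ⟨x, w⟩) : v = w := by
  injection h

end CBundle

/-! ### Cocycles, the central extension, projective representations -/

section Cocycles

variable (G : Type v) [Group G]

/-- A normalized 2-cocycle on `G` with values in the circle (with trivial action). -/
structure Cocycle where
  toFun : G → G → Circle
  map_one_one : toFun 1 1 = 1
  cocycle : ∀ g h k, toFun g h * toFun (g * h) k = toFun g (h * k) * toFun h k

variable {G}

theorem Cocycle.one_left (α : Cocycle G) (g : G) : α.toFun 1 g = 1 := by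
  simpa [α.map_one_one] using α.cocycle 1 1 g

theorem Cocycle.one_right (α : Cocycle G) (g : G) : α.toFun g 1 = 1 := by
  simpa [α.map_one_one] using α.cocycle g 1 1

/-- The pullback of a cocycle along a homomorphism. -/
def Cocycle.comap {G' : Type w} [Group G'] (α : Cocycle G') (h : G →* G') : Cocycle G where
  toFun a b := α.toFun (h a) (h b)
  map_one_one := by simpa using α.map_one_one
  cocycle a b c := by simpa using α.cocycle (h a) (h b) (h c)

/-- The central extension of `G` by the circle defined by the cocycle `α`: pairs `(g, a)` with
`(g, a) (h, b) = (g h, α(g, h) a b)`. -/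
@[ext]
structure Ext (α : Cocycle G) where
  proj : G
  phase : Circle

namespace Ext

variable {α : Cocycle G}

noncomputable instance : Mul (Ext α) :=
  ⟨fun γ δ => ⟨γ.proj * δ.proj, α.toFun γ.proj δ.proj * γ.phase * δ.phase⟩⟩

noncomputable instance : One (Ext α) := ⟨⟨1, 1⟩⟩

noncomputable instance : Inv (Ext α) :=
  ⟨fun γ => ⟨γ.proj⁻¹, (α.toFun γ.proj⁻¹ γ.proj * γ.phase)⁻¹⟩⟩

@[simp] theorem mul_proj (γ δ : Ext α) : (γ * δ).proj = γ.proj * δ.proj := rfl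

@[simp] theorem mul_phase (γ δ : Ext α) :
    (γ * δ).phase = α.toFun γ.proj δ.proj * γ.phase * δ.phase := rfl

@[simp] theorem one_proj : (1 : Ext α).proj = 1 := rfl

@[simp] theorem one_phase : (1 : Ext α).phase = 1 := rfl

@[simp] theorem inv_proj (γ : Ext α) : (γ⁻¹).proj = γ.proj⁻¹ := rfl

@[simp] theorem inv_phase (γ : Ext α) :
    (γ⁻¹).phase = (α.toFun γ.proj⁻¹ γ.proj * γ.phase)⁻¹ := rfl

noncomputable instance : Group (Ext α) :=
  Group.ofLeftAxioms
    (fun a b c => by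
      ext1
      · simp [mul_assoc]
      · have h := α.cocycle a.proj b.proj c.proj
        simp only [mul_phase, mul_proj]
        calc α.toFun (a.proj * b.proj) c.proj * (α.toFun a.proj b.proj * a.phase * b.phase) *
              c.phase
            = (α.toFun a.proj b.proj * α.toFun (a.proj * b.proj) c.proj) *
              (a.phase * b.phase * c.phase) := by
              simp only [mul_comm, mul_left_comm, mul_assoc]
          _ = α.toFun a.proj (b.proj * c.proj) * a.phase *
              (α.toFun b.proj c.proj * b.phase * c.phase) := by
              rw [h]; simp only [mul_comm, mul_left_comm, mul_assoc])
    (fun a => by ext1 <;> simp [α.one_left])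
    (fun a => by
      ext1
      · simp
      · simp only [mul_phase, inv_phase, inv_proj, one_phase, mul_inv]
        rw [mul_assoc, mul_assoc, inv_mul_cancel, mul_one, mul_inv_cancel])

/-- The extension carries the product topology of the discrete group `G` and the circle. -/
noncomputable instance : TopologicalSpace (Ext α) :=
  letI : TopologicalSpace G := ⊥
  TopologicalSpace.induced (fun γ => (γ.proj, γ.phase)) inferInstance

/-- The homomorphism of extensions covering `h : G → G'`. -/
noncomputable def map {G' : Type w} [Group G'] {α : Cocycle G'} (h : G →* G') : Ext (α.comap h) →* Ext α where
  toFun γ := ⟨h γ.proj, γ.phase⟩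
  map_one' := by ext1 <;> simp
  map_mul' γ δ := by
    ext1
    · exact map_mul h γ.proj δ.proj
    · rfl

theorem continuous_of_slices {Z W : Type*} [TopologicalSpace Z] [TopologicalSpace W]
    {f : Ext α × Z → W}
    (h : ∀ g : G, Continuous fun p : Circle × Z => f (⟨g, p.1⟩, p.2)) : Continuous f := by
  let _ : TopologicalSpace G := ⊥
  have : DiscreteTopology G := ⟨rfl⟩
  have h1 : Continuous fun p : G × (Circle × Z) => f (⟨p.1, p.2.1⟩, p.2.2) :=
    continuous_prod_of_discrete_left.2 h
  have h2 : Continuous fun γ : Ext α => (γ.proj, γ.phase) := continuous_induced_dom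
  have h3 : Continuous fun p : Ext α × Z => (p.1.proj, (p.1.phase, p.2)) := by
    have h4 := h2.comp (continuous_fst (X := Ext α) (Y := Z))
    exact (continuous_fst.comp h4).prodMk ((continuous_snd.comp h4).prodMk continuous_snd)
  exact h1.comp h3

theorem continuous_mk (g : G) : Continuous fun z : Circle => (⟨g, z⟩ : Ext α) := by
  let _ : TopologicalSpace G := ⊥
  refine continuous_induced_rng.2 ?_
  exact continuous_const.prodMk continuous_id

theorem continuous_map {G' : Type w} [Group G'] {α : Cocycle G'} (h : G →* G') :
    Continuous (map h : Ext (α.comap h) → Ext α) := by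
  have : Continuous fun p : Ext (α.comap h) × Unit => (map h p.1 : Ext α) :=
    continuous_of_slices fun g => (continuous_mk (α := α) (h g)).comp continuous_fst
  exact this.comp (continuous_id.prodMk (continuous_const (y := ())))

end Ext

/-- An `α`-representation of `G`: a finite-dimensional complex vector space `V` with
`ρ : G → GL(V)` such that `ρ(g) ρ(h) = α(g, h) ρ(g h)` and `ρ(1) = 1`. -/
structure AlphaRep (α : Cocycle G) where
  V : Type
  [acg : AddCommGroup V]
  [mod : Module ℂ V]
  [fin : FiniteDimensional ℂ V]
  ρ : G → (V ≃ₗ[ℂ] V)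
  map_one : ∀ v, ρ 1 v = v
  map_mul : ∀ g h v, ρ g (ρ h v) = (α.toFun g h : ℂ) • ρ (g * h) v

attribute [instance] AlphaRep.acg AlphaRep.mod AlphaRep.fin

namespace AlphaRep

variable {α : Cocycle G}

/-- The action `ψ(g, a) = a ρ(g)` of the central extension. -/
def extAct (M : AlphaRep α) (γ : Ext α) : M.V →ₗ[ℂ] M.V :=
  (γ.phase : ℂ) • (M.ρ γ.proj).toLinearMap

theorem extAct_apply (M : AlphaRep α) (γ : Ext α) (v : M.V) :
    M.extAct γ v = (γ.phase : ℂ) • M.ρ γ.proj v := rfl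

theorem extAct_one (M : AlphaRep α) : M.extAct 1 = LinearMap.id := by
  ext v; simp [extAct_apply, M.map_one]

theorem extAct_mul (M : AlphaRep α) (γ δ : Ext α) :
    M.extAct (γ * δ) = M.extAct γ ∘ₗ M.extAct δ := by
  ext v
  simp only [extAct_apply, LinearMap.comp_apply, map_smul, M.map_mul, smul_smul, Ext.mul_phase,
    Circle.coe_mul, Ext.mul_proj]
  congr 1; ring

theorem extAct_circle (M : AlphaRep α) (z : Circle) :
    M.extAct ⟨1, z⟩ = (z : ℂ) • LinearMap.id := by
  ext v; simp [extAct_apply, M.map_one]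

/-- Linear equivalence of `α`-representations. -/
structure Iso (M N : AlphaRep α) where
  toEquiv : M.V ≃ₗ[ℂ] N.V
  map_ρ : ∀ g v, toEquiv (M.ρ g v) = N.ρ g (toEquiv v)

namespace Iso

def refl (M : AlphaRep α) : Iso M M := ⟨LinearEquiv.refl ℂ _, fun _ _ => rfl⟩

def symm {M N : AlphaRep α} (φ : Iso M N) : Iso N M :=
  ⟨φ.toEquiv.symm, fun g v => by
    rw [LinearEquiv.symm_apply_eq, φ.map_ρ, LinearEquiv.apply_symm_apply]⟩

def trans {M N P : AlphaRep α} (φ : Iso M N) (ψ : Iso N P) : Iso M P :=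
  ⟨φ.toEquiv.trans ψ.toEquiv, fun g v => by simp [φ.map_ρ, ψ.map_ρ]⟩

theorem map_extAct {M N : AlphaRep α} (φ : Iso M N) (γ : Ext α) (v : M.V) :
    φ.toEquiv (M.extAct γ v) = N.extAct γ (φ.toEquiv v) := by
  simp [extAct_apply, φ.map_ρ]

end Iso

/-- The zero representation. -/
def zero (α : Cocycle G) : AlphaRep α where
  V := Unit
  ρ _ := LinearEquiv.refl ℂ _
  map_one _ := rfl
  map_mul _ _ _ := rfl

/-- The direct sum. -/
def sum (M N : AlphaRep α) : AlphaRep α where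
  V := M.V × N.V
  ρ g := (M.ρ g).prodCongr (N.ρ g)
  map_one v := by simp [M.map_one, N.map_one]
  map_mul g h v := by simp [M.map_mul, N.map_mul, Prod.smul_def]

/-- Restriction along a homomorphism. -/
def comap {G' : Type w} [Group G'] {α : Cocycle G'} (M : AlphaRep α) (h : G →* G') :
    AlphaRep (α.comap h) where
  V := M.V
  ρ g := M.ρ (h g)
  map_one v := by simp [M.map_one]
  map_mul a b v := by simp [M.map_mul, Cocycle.comap]

/-- Irreducibility: `V ≠ 0`, and `0` and `V` are the only invariant subspaces. -/
def IsIrreducible (M : AlphaRep α) : Prop :=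
  Nontrivial M.V ∧ ∀ W : Submodule ℂ M.V, (∀ g, ∀ v ∈ W, M.ρ g v ∈ W) → W = ⊥ ∨ W = ⊤

/-- `M` lists the irreducible `α`-representations, each one exactly once up to isomorphism. -/
def IsCompleteIrr {ι : Type} (M : ι → AlphaRep α) : Prop :=
  (∀ i, (M i).IsIrreducible) ∧ (∀ i j, Nonempty (Iso (M i) (M j)) → i = j) ∧
    ∀ N : AlphaRep α, N.IsIrreducible → ∃ i, Nonempty (Iso N (M i))

instance setoid (α : Cocycle G) : Setoid (AlphaRep α) where
  r M N := Nonempty (Iso M N)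
  iseqv := ⟨fun M => ⟨.refl M⟩, fun ⟨φ⟩ => ⟨φ.symm⟩, fun ⟨φ⟩ ⟨ψ⟩ => ⟨φ.trans ψ⟩⟩

end AlphaRep

/-- The monoid of linear isomorphism classes of `α`-representations. -/
def RepClass (α : Cocycle G) := Quotient (AlphaRep.setoid α)

instance (α : Cocycle G) : Zero (RepClass α) := ⟨Quotient.mk _ (AlphaRep.zero α)⟩

instance (α : Cocycle G) : Add (RepClass α) where
  add := Quotient.map₂ AlphaRep.sum fun _ _ ⟨φ⟩ _ _ ⟨ψ⟩ =>
    ⟨⟨φ.toEquiv.prodCongr ψ.toEquiv, fun g v => Prod.ext (φ.map_ρ g v.1) (ψ.map_ρ g v.2)⟩⟩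

instance (α : Cocycle G) : AddCommMonoid (RepClass α) where
  add_assoc := by
    rintro ⟨M⟩ ⟨N⟩ ⟨P⟩
    exact Quotient.sound ⟨⟨LinearEquiv.prodAssoc ℂ _ _ _, fun g v => rfl⟩⟩
  zero_add := by
    rintro ⟨M⟩
    exact Quotient.sound ⟨⟨(LinearEquiv.prodComm ℂ Unit M.V).trans (LinearEquiv.prodUnique (M₂ := Unit)),
      fun g v => rfl⟩⟩
  add_zero := by
    rintro ⟨M⟩
    exact Quotient.sound ⟨⟨LinearEquiv.prodUnique (M₂ := Unit), fun g v => rfl⟩⟩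
  add_comm := by
    rintro ⟨M⟩ ⟨N⟩
    exact Quotient.sound ⟨⟨LinearEquiv.prodComm ℂ _ _, fun g v => rfl⟩⟩
  nsmul := nsmulRec

end Cocycles

/-! ### Twisted equivariant bundles -/

section Twisted

variable {G : Type v} [Group G]

/-- An `α`-twisted `G`-vector bundle on the `G`-space `X`: a complex vector bundle with a continuous
action of the extension of `G` by the circle defined by `α`, linear on the fibres, which covers the
action of `G` on `X` and for which the central circle acts by complex multiplication. -/
structure TwistedBundle (α : Cocycle G) (X : Type u) [TopologicalSpace X] [MulAction G X] extends
    CBundle X where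
  act : ∀ (γ : Ext α) (x : X), fiber x →ₗ[ℂ] fiber (γ.proj • x)
  one_act : ∀ x v, (⟨_, act 1 x v⟩ : Tot fiber) = ⟨x, v⟩
  mul_act : ∀ γ δ x v, (⟨_, act (γ * δ) x v⟩ : Tot fiber) = ⟨_, act γ _ (act δ x v)⟩
  circle_act : ∀ (z : Circle) x v, (⟨_, act ⟨1, z⟩ x v⟩ : Tot fiber) = ⟨x, (z : ℂ) • v⟩
  continuous_act : Continuous fun p : Ext α × Tot fiber =>
    (⟨p.1.proj • p.2.base, act p.1 p.2.base p.2.vec⟩ : Tot fiber)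

namespace TwistedBundle

variable {α : Cocycle G} {X : Type u} [TopologicalSpace X] [MulAction G X]

theorem act_congr (E : TwistedBundle α X) (γ : Ext α) {x y : X} {v : E.fiber x} {w : E.fiber y}
    (h : (⟨x, v⟩ : Tot E.fiber) = ⟨y, w⟩) :
    (⟨_, E.act γ x v⟩ : Tot E.fiber) = ⟨_, E.act γ y w⟩ := by
  cases h; rfl

theorem act_eq (E : TwistedBundle α X) {γ δ : Ext α} (h : γ = δ) (x : X) (v : E.fiber x) :
    (⟨_, E.act γ x v⟩ : Tot E.fiber) = ⟨_, E.act δ x v⟩ := by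
  cases h; rfl

/-- An isomorphism of twisted bundles. -/
structure Iso (E E' : TwistedBundle α X) extends CBundle.Iso E.toCBundle E'.toCBundle where
  equivariant : ∀ γ x v, toEquiv (γ.proj • x) (E.act γ x v) = E'.act γ x (toEquiv x v)

namespace Iso

def refl (E : TwistedBundle α X) : Iso E E where
  toIso := CBundle.Iso.refl _
  equivariant _ _ _ := rfl

def symm {E E' : TwistedBundle α X} (φ : Iso E E') : Iso E' E where
  toIso := φ.toIso.symm
  equivariant γ x v := by
    change (φ.toEquiv _).symm _ = E.act γ x ((φ.toEquiv x).symm v)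
    rw [LinearEquiv.symm_apply_eq, φ.equivariant, LinearEquiv.apply_symm_apply]

def trans {E E' E'' : TwistedBundle α X} (φ : Iso E E') (ψ : Iso E' E'') : Iso E E'' where
  toIso := φ.toIso.trans ψ.toIso
  equivariant γ x v := by
    change ψ.toEquiv _ (φ.toEquiv _ _) = E''.act γ x (ψ.toEquiv _ (φ.toEquiv _ _))
    rw [φ.equivariant, ψ.equivariant]

end Iso

/-- The zero twisted bundle. -/
def zero (α : Cocycle G) (X : Type u) [TopologicalSpace X] [MulAction G X]
    [ContinuousConstSMul G X] : TwistedBundle α X where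
  toCBundle := CBundle.zero X
  act _ _ := LinearMap.id
  one_act x _ := congrArg (fun y => (⟨y, ()⟩ : Tot (CBundle.zero X).fiber)) (one_smul G x)
  mul_act γ δ x _ := congrArg (fun y => (⟨y, ()⟩ : Tot (CBundle.zero X).fiber))
    (mul_smul γ.proj δ.proj x)
  circle_act _ x _ := congrArg (fun y => (⟨y, ()⟩ : Tot (CBundle.zero X).fiber)) (one_smul G x)
  continuous_act := Ext.continuous_of_slices fun g => (CBundle.zero X).continuous_zero.comp
    (((CBundle.zero X).continuous_base.comp continuous_snd).const_smul g)

theorem mk_prod_congr {X : Type u} {E E' : X → Type} {x y : X} {v : E x × E' x} {w : E y × E' y}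
    (h : (⟨x, v.1⟩ : Tot E) = ⟨y, w.1⟩) (h' : (⟨x, v.2⟩ : Tot E') = ⟨y, w.2⟩) :
    (⟨x, v⟩ : Tot fun x => E x × E' x) = ⟨y, w⟩ := by
  obtain ⟨v, v'⟩ := v
  obtain ⟨w, w'⟩ := w
  cases h; cases h'; rfl

/-- The direct sum of twisted bundles. -/
def sum (E E' : TwistedBundle α X) : TwistedBundle α X where
  toCBundle := E.toCBundle.sum E'.toCBundle
  act γ x := (E.act γ x).prodMap (E'.act γ x)
  one_act x v := mk_prod_congr (E.one_act x v.1) (E'.one_act x v.2)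
  mul_act γ δ x v := mk_prod_congr (E.mul_act γ δ x v.1) (E'.mul_act γ δ x v.2)
  circle_act z x v := mk_prod_congr (E.circle_act z x v.1) (E'.circle_act z x v.2)
  continuous_act := by
    refine CBundle.continuous_sum_mk ?_ ?_
    · exact E.continuous_act.comp (continuous_fst.prodMk
        (CBundle.continuous_sum_fst (E' := E'.toCBundle) continuous_snd))
    · exact E'.continuous_act.comp (continuous_fst.prodMk
        (CBundle.continuous_sum_snd (E := E.toCBundle) continuous_snd))

namespace Iso

def sumCongr {E₁ E₂ E₁' E₂' : TwistedBundle α X} (φ : Iso E₁ E₁') (ψ : Iso E₂ E₂') :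
    Iso (E₁.sum E₂) (E₁'.sum E₂') where
  toIso := φ.toIso.sumCongr ψ.toIso
  equivariant γ x v := Prod.ext (φ.equivariant γ x v.1) (ψ.equivariant γ x v.2)

def sumComm (E E' : TwistedBundle α X) : Iso (E.sum E') (E'.sum E) where
  toIso := CBundle.Iso.sumComm _ _
  equivariant _ _ _ := rfl

def sumAssoc (E E' E'' : TwistedBundle α X) : Iso ((E.sum E').sum E'') (E.sum (E'.sum E'')) where
  toIso := CBundle.Iso.sumAssoc _ _ _
  equivariant _ _ _ := rfl

def zeroSum [ContinuousConstSMul G X] (E : TwistedBundle α X) : Iso ((zero α X).sum E) E where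
  toIso := CBundle.Iso.zeroSum _
  equivariant _ _ _ := rfl

end Iso

/-! #### Pullbacks -/

section Pullback

variable {G' : Type w} [Group G'] {β : Cocycle G'} {Y : Type*} [TopologicalSpace Y] [MulAction G' Y]
  (E : TwistedBundle β Y) (h : G →* G') (f : C(X, Y)) (hf : ∀ (g : G) (x : X), f (g • x) = h g • f x)

theorem mk_pullback_congr (E : CBundle Y) (f : C(X, Y)) {x y : X} (hxy : x = y)
    {v : E.fiber (f x)} {w : E.fiber (f y)} (hvw : (⟨f x, v⟩ : Tot E.fiber) = ⟨f y, w⟩) :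
    (⟨x, v⟩ : Tot (E.pullback f).fiber) = ⟨y, w⟩ := by
  subst hxy
  cases hvw; rfl

/-- The pullback of a twisted bundle along a map `f` which is equivariant with respect to the
homomorphism `h`. -/
noncomputable def pullback [ContinuousConstSMul G X] : TwistedBundle (β.comap h) X where
  toCBundle := E.toCBundle.pullback f
  act γ x := (E.castFiber (hf γ.proj x).symm).toLinearMap ∘ₗ E.act (Ext.map h γ) (f x)
  one_act x v := mk_pullback_congr _ f (one_smul G x) <| by
    refine (E.mk_castFiber _ _).trans ?_
    exact (E.act_eq (map_one (Ext.map h)) (f x) v).trans (E.one_act (f x) v)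
  mul_act γ δ x v := mk_pullback_congr _ f (mul_smul γ.proj δ.proj x) <| by
    refine (E.mk_castFiber _ _).trans (Eq.trans ?_ (E.mk_castFiber _ _).symm)
    refine (E.act_eq (map_mul (Ext.map h) γ δ) (f x) v).trans ((E.mul_act _ _ (f x) v).trans ?_)
    exact E.act_congr _ (E.mk_castFiber _ _).symm
  circle_act z x v := mk_pullback_congr _ f (one_smul G x) <| by
    refine (E.mk_castFiber _ _).trans ?_
    have : (Ext.map h ⟨1, z⟩ : Ext β) = ⟨1, z⟩ := by
      ext1
      · exact map_one h
      · rfl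
    exact (E.act_eq this (f x) v).trans (E.circle_act z (f x) v)
  continuous_act := by
    have hc := (CBundle.continuous_pullback_iff E.toCBundle f).1
      (continuous_snd (X := Ext (β.comap h)) (Y := Tot (E.toCBundle.pullback f).fiber))
    refine (CBundle.continuous_pullback_iff E.toCBundle f).2 ⟨?_, ?_⟩
    · exact Ext.continuous_of_slices fun g =>
        ((((E.toCBundle.pullback f).continuous_base).comp continuous_snd).const_smul g)
    · refine (E.continuous_act.comp
        (((Ext.continuous_map h).comp continuous_fst).prodMk hc.2)).congr fun p => ?_
      exact (E.mk_castFiber _ _).symm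

end Pullback

instance setoid (α : Cocycle G) (X : Type u) [TopologicalSpace X] [MulAction G X] :
    Setoid (TwistedBundle α X) where
  r E E' := Nonempty (Iso E E')
  iseqv := ⟨fun M => ⟨.refl M⟩, fun ⟨φ⟩ => ⟨φ.symm⟩, fun ⟨φ⟩ ⟨ψ⟩ => ⟨φ.trans ψ⟩⟩

end TwistedBundle

/-! #### The product of a vector bundle with an `α`-representation, and the bundle of homs -/

section TrivialAction

variable {α : Cocycle G} {X : Type u} [TopologicalSpace X] [MulAction G X]

theorem CBundle.mk_map_castFiber (E : CBundle X) (V : Type) [AddCommGroup V] [Module ℂ V]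
    [FiniteDimensional ℂ V] (L : V →ₗ[ℂ] V) {x y : X} (h : x = y) (t : E.fiber x ⊗[ℂ] V) :
    (⟨y, TensorProduct.map (E.castFiber h).toLinearMap L t⟩ : Tot (E.tensor V).fiber) =
      ⟨x, L.lTensor _ t⟩ := by
  subst h; rfl

theorem CBundle.contr_lTensor {F V : Type} [AddCommGroup F] [Module ℂ F] [AddCommGroup V]
    [Module ℂ V] {W : Type} [AddCommGroup W] [Module ℂ W] (θ : Module.Dual ℂ W) (L : V →ₗ[ℂ] W)
    (t : F ⊗[ℂ] V) : contr F θ (L.lTensor F t) = contr F (θ ∘ₗ L) t := by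
  induction t using TensorProduct.induction_on with
  | zero => simp
  | tmul e v => simp
  | add s t hs ht => simp [hs, ht]

theorem CBundle.contr_smul {F V : Type} [AddCommGroup F] [Module ℂ F] [AddCommGroup V]
    [Module ℂ V] (c : ℂ) (θ : Module.Dual ℂ V)
    (t : F ⊗[ℂ] V) : contr F (c • θ) t = c • contr F θ t := by
  induction t using TensorProduct.induction_on with
  | zero => simp
  | tmul e v => simp [smul_smul]
  | add s t hs ht => simp [hs, ht]

theorem CBundle.contr_lTensor_smul {F V : Type} [AddCommGroup F] [Module ℂ F] [AddCommGroup V]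
    [Module ℂ V] (c : ℂ) (θ : Module.Dual ℂ V) (L : V →ₗ[ℂ] V) (t : F ⊗[ℂ] V) :
    contr F θ ((c • L).lTensor F t) = c • contr F (θ ∘ₗ L) t := by
  rw [contr_lTensor, LinearMap.comp_smul, contr_smul]

section Linear

open CBundle

variable {F F' V V' : Type} [AddCommGroup F] [Module ℂ F] [AddCommGroup F'] [Module ℂ F']
  [AddCommGroup V] [Module ℂ V] [AddCommGroup V'] [Module ℂ V']

theorem contr_prodLeft (θ : Module.Dual ℂ V) (t : (F × F') ⊗[ℂ] V) :
    contr (F × F') θ t = (contr F θ (TensorProduct.prodLeft ℂ ℂ F F' V t).1,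
      contr F' θ (TensorProduct.prodLeft ℂ ℂ F F' V t).2) := by
  induction t using TensorProduct.induction_on with
  | zero => simp; rfl
  | tmul e v => obtain ⟨a, b⟩ := e; simp
  | add s t hs ht => rw [map_add, hs, ht]; simp

theorem contr_prodLeft_symm (θ : Module.Dual ℂ V) (s : F ⊗[ℂ] V) (t : F' ⊗[ℂ] V) :
    contr (F × F') θ ((TensorProduct.prodLeft ℂ ℂ F F' V).symm (s, t)) =
      (contr F θ s, contr F' θ t) := by
  rw [contr_prodLeft, LinearEquiv.apply_symm_apply]

theorem map_prodLeft (L : V →ₗ[ℂ] V) (t : (F × F') ⊗[ℂ] V) :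
    TensorProduct.prodLeft ℂ ℂ F F' V (TensorProduct.map LinearMap.id L t) =
      (TensorProduct.map LinearMap.id L (TensorProduct.prodLeft ℂ ℂ F F' V t).1,
        TensorProduct.map LinearMap.id L (TensorProduct.prodLeft ℂ ℂ F F' V t).2) := by
  induction t using TensorProduct.induction_on with
  | zero => simp; rfl
  | tmul e v => obtain ⟨a, b⟩ := e; simp
  | add s t hs ht => rw [map_add, map_add, hs, ht]; simp

theorem contr_prodRight_fst (θ : Module.Dual ℂ V) (t : F ⊗[ℂ] (V × V')) :
    contr F (θ ∘ₗ LinearMap.fst ℂ V V') t =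
      contr F θ (TensorProduct.prodRight ℂ ℂ F V V' t).1 := by
  induction t using TensorProduct.induction_on with
  | zero => simp
  | tmul e v => simp
  | add s t hs ht => rw [map_add, hs, ht]; simp

theorem contr_prodRight_snd (θ : Module.Dual ℂ V') (t : F ⊗[ℂ] (V × V')) :
    contr F (θ ∘ₗ LinearMap.snd ℂ V V') t =
      contr F θ (TensorProduct.prodRight ℂ ℂ F V V' t).2 := by
  induction t using TensorProduct.induction_on with
  | zero => simp
  | tmul e v => simp
  | add s t hs ht => rw [map_add, hs, ht]; simp

theorem contr_prodRight_symm (θ : Module.Dual ℂ (V × V')) (s : F ⊗[ℂ] V) (t : F ⊗[ℂ] V') :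
    contr F θ ((TensorProduct.prodRight ℂ ℂ F V V').symm (s, t)) =
      contr F (θ ∘ₗ LinearMap.inl ℂ V V') s + contr F (θ ∘ₗ LinearMap.inr ℂ V V') t := by
  rw [← contr_lTensor, ← contr_lTensor, ← map_add]; rfl

theorem map_prodRight (L : V →ₗ[ℂ] V) (L' : V' →ₗ[ℂ] V') (t : F ⊗[ℂ] (V × V')) :
    TensorProduct.prodRight ℂ ℂ F V V' (TensorProduct.map LinearMap.id (L.prodMap L') t) =
      (TensorProduct.map LinearMap.id L (TensorProduct.prodRight ℂ ℂ F V V' t).1,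
        TensorProduct.map LinearMap.id L' (TensorProduct.prodRight ℂ ℂ F V V' t).2) := by
  induction t using TensorProduct.induction_on with
  | zero => simp; rfl
  | tmul e v => simp
  | add s t hs ht => rw [map_add, map_add, hs, ht]; simp

end Linear

/-- For a trivial `G`-space `X`: the twisted bundle `E ⊗ M`, where `E` carries the trivial action
and `M` is an `α`-representation. -/
noncomputable def tensorTwisted (triv : ∀ (g : G) (x : X), g • x = x) (E : CBundle X)
    (M : AlphaRep α) : TwistedBundle α X where
  toCBundle := E.tensor M.V
  act γ x := TensorProduct.map (E.castFiber (triv γ.proj x).symm).toLinearMap (M.extAct γ)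
  one_act x v := by
    refine (E.mk_map_castFiber _ _ _ _).trans ?_
    rw [M.extAct_one, LinearMap.lTensor_id]; rfl
  mul_act γ δ x v := by
    refine (E.mk_map_castFiber _ _ _ _).trans (Eq.trans ?_ (E.mk_map_castFiber _ _ _ _).symm)
    rw [M.extAct_mul, LinearMap.lTensor_comp]
    have h := E.mk_map_castFiber M.V (M.extAct δ) (triv δ.proj x).symm v
    have key : ∀ {y z : X} {s : E.fiber y ⊗[ℂ] M.V} {t : E.fiber z ⊗[ℂ] M.V},
        (⟨y, s⟩ : Tot (E.tensor M.V).fiber) = ⟨z, t⟩ →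
        (⟨z, (M.extAct γ).lTensor _ t⟩ : Tot (E.tensor M.V).fiber) =
          ⟨y, (M.extAct γ).lTensor _ s⟩ := by
      intro y z s t h; cases h; rfl
    exact key h
  circle_act z x v := by
    refine (E.mk_map_castFiber _ _ _ _).trans ?_
    rw [M.extAct_circle, LinearMap.lTensor_smul, LinearMap.lTensor_id]; rfl
  continuous_act := by
    refine Ext.continuous_of_slices fun g => ?_
    have hc := (CBundle.continuous_tensor_iff E M.V).1
      (continuous_snd (X := Circle) (Y := Tot (E.tensor M.V).fiber))
    have h1 : Continuous fun p : Circle × Tot (E.tensor M.V).fiber =>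
        (⟨p.2.base, (M.extAct ⟨g, p.1⟩).lTensor _ p.2.vec⟩ : Tot (E.tensor M.V).fiber) := by
      refine (CBundle.continuous_tensor_iff E M.V).2 ⟨hc.1, fun θ => ?_⟩
      have h2 := E.continuous_smul (c := fun p : Circle × Tot (E.tensor M.V).fiber => (p.1 : ℂ))
        (by fun_prop) (hc.2 (θ ∘ₗ (M.ρ g).toLinearMap))
      refine h2.congr fun p => ?_
      exact congrArg (fun v => (⟨p.2.base, v⟩ : Tot E.fiber))
        (CBundle.contr_lTensor_smul (p.1 : ℂ) θ (M.ρ g).toLinearMap p.2.vec).symm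
    exact h1.congr fun p => (E.mk_map_castFiber _ _ _ _).symm

/-- An isomorphism of vector bundles which is also compatible with the representations. -/
noncomputable def tensorTwistedCongr (triv : ∀ (g : G) (x : X), g • x = x) {E E' : CBundle X}
    {M M' : AlphaRep α} (φ : E.Iso E') (ψ : M.Iso M') :
    (tensorTwisted triv E M).Iso (tensorTwisted triv E' M') where
  toEquiv x := TensorProduct.congr (φ.toEquiv x) ψ.toEquiv
  continuous_toFun := by
    have hc := (CBundle.continuous_tensor_iff E M.V).1 continuous_id
    refine (CBundle.continuous_tensor_iff E' M'.V).2 ⟨hc.1, fun θ => ?_⟩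
    refine (φ.continuous_map (hc.2 (θ ∘ₗ ψ.toEquiv.toLinearMap))).congr fun e => ?_
    obtain ⟨x, t⟩ := e
    congr 1
    change φ.toEquiv x (CBundle.contr _ _ t) =
      CBundle.contr _ θ (TensorProduct.congr (φ.toEquiv x) ψ.toEquiv t)
    induction t using TensorProduct.induction_on with
    | zero => simp
    | tmul e v => simp
    | add s t hs ht => simp only [map_add, hs, ht]
  continuous_invFun := by
    have hc := (CBundle.continuous_tensor_iff E' M'.V).1 continuous_id
    refine (CBundle.continuous_tensor_iff E M.V).2 ⟨hc.1, fun θ => ?_⟩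
    refine (φ.symm.continuous_map (hc.2 (θ ∘ₗ ψ.symm.toEquiv.toLinearMap))).congr fun e => ?_
    obtain ⟨x, t⟩ := e
    congr 1
    change (φ.toEquiv x).symm (CBundle.contr _ _ t) =
      CBundle.contr _ θ ((TensorProduct.congr (φ.toEquiv x) ψ.toEquiv).symm t)
    induction t using TensorProduct.induction_on with
    | zero => simp
    | tmul e v => simp [AlphaRep.Iso.symm]
    | add s t hs ht => simp only [map_add, hs, ht]
  equivariant γ x t := by
    have key : ∀ {y : X} (h : x = y) (t : E.fiber x ⊗[ℂ] M.V),
        TensorProduct.congr (φ.toEquiv y) ψ.toEquiv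
          (TensorProduct.map (E.castFiber h).toLinearMap (M.extAct γ) t) =
        TensorProduct.map (E'.castFiber h).toLinearMap (M'.extAct γ)
          (TensorProduct.congr (φ.toEquiv x) ψ.toEquiv t) := by
      intro y h t
      subst h
      induction t using TensorProduct.induction_on with
      | zero => simp
      | tmul e v => simp [ψ.map_extAct]
      | add s t hs ht => simp only [map_add, hs, ht]
    exact key (triv γ.proj x).symm t

noncomputable def tensorTwistedSumLeft (triv : ∀ (g : G) (x : X), g • x = x) (E E' : CBundle X)
    (M : AlphaRep α) : (tensorTwisted triv (E.sum E') M).Iso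
      ((tensorTwisted triv E M).sum (tensorTwisted triv E' M)) where
  toEquiv x := TensorProduct.prodLeft ℂ ℂ (E.fiber x) (E'.fiber x) M.V
  continuous_toFun := by
    have hc := (CBundle.continuous_tensor_iff (E.sum E') M.V).1 continuous_id
    refine CBundle.continuous_sum_mk (E := E.tensor M.V) (E' := E'.tensor M.V)
      (f := fun e : Tot ((E.sum E').tensor M.V).fiber => e.base)
      (s := fun e => (TensorProduct.prodLeft ℂ ℂ (E.fiber e.base) (E'.fiber e.base) M.V e.vec).1)
      (t := fun e => (TensorProduct.prodLeft ℂ ℂ (E.fiber e.base) (E'.fiber e.base) M.V e.vec).2)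
      ?_ ?_
    · refine (CBundle.continuous_tensor_iff E M.V).2 ⟨hc.1, fun θ => ?_⟩
      exact (CBundle.continuous_sum_fst (hc.2 θ)).congr fun e =>
        congrArg (fun v => (⟨e.base, v⟩ : Tot E.fiber)) (congrArg Prod.fst (contr_prodLeft θ e.vec))
    · refine (CBundle.continuous_tensor_iff E' M.V).2 ⟨hc.1, fun θ => ?_⟩
      exact (CBundle.continuous_sum_snd (hc.2 θ)).congr fun e =>
        congrArg (fun v => (⟨e.base, v⟩ : Tot E'.fiber))
          (congrArg Prod.snd (contr_prodLeft θ e.vec))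
  continuous_invFun := by
    have hs := (CBundle.continuous_sum_iff (E.tensor M.V) (E'.tensor M.V)).1
      (continuous_id (X := Tot ((E.tensor M.V).sum (E'.tensor M.V)).fiber))
    have h1 := (CBundle.continuous_tensor_iff E M.V).1 hs.1
    have h2 := (CBundle.continuous_tensor_iff E' M.V).1 hs.2
    refine (CBundle.continuous_tensor_iff (E.sum E') M.V).2 ⟨h1.1, fun θ => ?_⟩
    exact (CBundle.continuous_sum_mk (h1.2 θ) (h2.2 θ)).congr fun e =>
      congrArg (fun v => (⟨e.base, v⟩ : Tot (E.sum E').fiber))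
        (contr_prodLeft_symm θ e.vec.1 e.vec.2).symm
  equivariant γ x t := by
    have key : ∀ {y : X} (h : x = y) (t : (E.fiber x × E'.fiber x) ⊗[ℂ] M.V),
        TensorProduct.prodLeft ℂ ℂ (E.fiber y) (E'.fiber y) M.V
          (TensorProduct.map ((E.sum E').castFiber h).toLinearMap (M.extAct γ) t) =
        (TensorProduct.map (E.castFiber h).toLinearMap (M.extAct γ)
          (TensorProduct.prodLeft ℂ ℂ (E.fiber x) (E'.fiber x) M.V t).1,
         TensorProduct.map (E'.castFiber h).toLinearMap (M.extAct γ)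
          (TensorProduct.prodLeft ℂ ℂ (E.fiber x) (E'.fiber x) M.V t).2) := by
      intro y h t
      subst h
      exact map_prodLeft (M.extAct γ) t
    exact key (triv γ.proj x).symm t

noncomputable def tensorTwistedSumRight (triv : ∀ (g : G) (x : X), g • x = x) (E : CBundle X)
    (M M' : AlphaRep α) : (tensorTwisted triv E (M.sum M')).Iso
      ((tensorTwisted triv E M).sum (tensorTwisted triv E M')) where
  toEquiv x := TensorProduct.prodRight ℂ ℂ (E.fiber x) M.V M'.V
  continuous_toFun := by
    have hc := (CBundle.continuous_tensor_iff E (M.V × M'.V)).1 continuous_id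
    refine CBundle.continuous_sum_mk (E := E.tensor M.V) (E' := E.tensor M'.V)
      (f := fun e : Tot (E.tensor (M.V × M'.V)).fiber => e.base)
      (s := fun e => (TensorProduct.prodRight ℂ ℂ (E.fiber e.base) M.V M'.V e.vec).1)
      (t := fun e => (TensorProduct.prodRight ℂ ℂ (E.fiber e.base) M.V M'.V e.vec).2)
      ?_ ?_
    · refine (CBundle.continuous_tensor_iff E M.V).2 ⟨hc.1, fun θ => ?_⟩
      exact (hc.2 (θ ∘ₗ LinearMap.fst ℂ M.V M'.V)).congr fun e =>
        congrArg (fun v => (⟨e.base, v⟩ : Tot E.fiber)) (contr_prodRight_fst θ e.vec)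
    · refine (CBundle.continuous_tensor_iff E M'.V).2 ⟨hc.1, fun θ => ?_⟩
      exact (hc.2 (θ ∘ₗ LinearMap.snd ℂ M.V M'.V)).congr fun e =>
        congrArg (fun v => (⟨e.base, v⟩ : Tot E.fiber)) (contr_prodRight_snd θ e.vec)
  continuous_invFun := by
    have hs := (CBundle.continuous_sum_iff (E.tensor M.V) (E.tensor M'.V)).1
      (continuous_id (X := Tot ((E.tensor M.V).sum (E.tensor M'.V)).fiber))
    have h1 := (CBundle.continuous_tensor_iff E M.V).1 hs.1
    have h2 := (CBundle.continuous_tensor_iff E M'.V).1 hs.2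
    refine (CBundle.continuous_tensor_iff E (M.V × M'.V)).2 ⟨h1.1, fun θ => ?_⟩
    exact (E.continuous_add (h1.2 (θ ∘ₗ LinearMap.inl ℂ M.V M'.V))
      (h2.2 (θ ∘ₗ LinearMap.inr ℂ M.V M'.V))).congr fun e =>
        congrArg (fun v => (⟨e.base, v⟩ : Tot E.fiber))
          (contr_prodRight_symm θ e.vec.1 e.vec.2).symm
  equivariant γ x t := by
    have key : ∀ {y : X} (h : x = y) (t : E.fiber x ⊗[ℂ] (M.V × M'.V)),
        TensorProduct.prodRight ℂ ℂ (E.fiber y) M.V M'.V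
          (TensorProduct.map (E.castFiber h).toLinearMap
            ((M.extAct γ).prodMap (M'.extAct γ)) t) =
        (TensorProduct.map (E.castFiber h).toLinearMap (M.extAct γ)
          (TensorProduct.prodRight ℂ ℂ (E.fiber x) M.V M'.V t).1,
         TensorProduct.map (E.castFiber h).toLinearMap (M'.extAct γ)
          (TensorProduct.prodRight ℂ ℂ (E.fiber x) M.V M'.V t).2) := by
      intro y h t
      subst h
      exact map_prodRight (M.extAct γ) (M'.extAct γ) t
    exact key (triv γ.proj x).symm t

namespace TwistedBundle

/-- For a trivial `G`-space: the action of the extension on the fibre over `x`. -/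
def fiberAct (triv : ∀ (g : G) (x : X), g • x = x) (E : TwistedBundle α X) (γ : Ext α) (x : X) :
    E.fiber x →ₗ[ℂ] E.fiber x :=
  (E.castFiber (triv γ.proj x)).toLinearMap ∘ₗ E.act γ x

variable (triv : ∀ (g : G) (x : X), g • x = x) (E : TwistedBundle α X)

theorem mk_fiberAct (γ : Ext α) (x : X) (v : E.fiber x) :
    (⟨x, E.fiberAct triv γ x v⟩ : Tot E.fiber) = ⟨_, E.act γ x v⟩ :=
  E.mk_castFiber _ _

theorem fiberAct_one (x : X) : E.fiberAct triv 1 x = 1 := by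
  ext v
  exact E.mk_inj ((E.mk_fiberAct triv 1 x v).trans (E.one_act x v))

theorem fiberAct_mul (γ δ : Ext α) (x : X) :
    E.fiberAct triv (γ * δ) x = E.fiberAct triv γ x * E.fiberAct triv δ x := by
  ext v
  refine E.mk_inj ((E.mk_fiberAct triv _ x v).trans ((E.mul_act γ δ x v).trans ?_))
  refine Eq.trans ?_ (E.mk_fiberAct triv γ x _).symm
  exact E.act_congr γ (E.mk_fiberAct triv δ x v).symm

theorem fiberAct_circle (z : Circle) (x : X) : E.fiberAct triv ⟨1, z⟩ x = (z : ℂ) • 1 := by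
  ext v
  exact E.mk_inj ((E.mk_fiberAct triv _ x v).trans (E.circle_act z x v))

theorem continuous_fiberAct (γ : Ext α) {Z : Type*} [TopologicalSpace Z] {f : Z → X}
    {s : ∀ z, E.fiber (f z)} (hs : Continuous fun z => (⟨f z, s z⟩ : Tot E.fiber)) :
    Continuous fun z => (⟨f z, E.fiberAct triv γ (f z) (s z)⟩ : Tot E.fiber) :=
  (E.continuous_act.comp ((continuous_const (y := γ)).prodMk hs)).congr fun _ =>
    (E.mk_fiberAct triv γ _ _).symm

end TwistedBundle

/-- The linear maps commuting with two families of operators. -/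
def intertwiners {ι : Type*} {V W : Type} [AddCommGroup V] [Module ℂ V] [AddCommGroup W]
    [Module ℂ W] (a : ι → V →ₗ[ℂ] V) (b : ι → W →ₗ[ℂ] W) : Submodule ℂ (V →ₗ[ℂ] W) where
  carrier := {f | ∀ i v, f (a i v) = b i (f v)}
  add_mem' {f f'} hf hf' i v := by simp [hf i v, hf' i v]
  zero_mem' i v := by simp
  smul_mem' c f hf i v := by simp [hf i v]

section Averaging

/-- Averaging over a finite group intertwines two representations of the extension. -/
theorem sum_intertwines [Fintype G] {B : Type*} [Ring B] [Algebra ℂ B] (A R : Ext α →* B)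
    (hA : ∀ z : Circle, A ⟨1, z⟩ = (z : ℂ) • 1) (hR : ∀ z : Circle, R ⟨1, z⟩ = (z : ℂ) • 1)
    (δ : Ext α) :
    (∑ g : G, A ⟨g, 1⟩ * R (⟨g, 1⟩⁻¹)) * R δ = A δ * ∑ g : G, A ⟨g, 1⟩ * R (⟨g, 1⟩⁻¹) := by
  have h1 : ∀ γ : Ext α, γ = ⟨1, γ.phase⟩ * ⟨γ.proj, 1⟩ := fun γ => by
    ext1 <;> simp [α.one_left]
  have h2 : ∀ z : Circle, (⟨1, z⟩ : Ext α)⁻¹ = ⟨1, z⁻¹⟩ := fun z => by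
    ext1 <;> simp [α.one_left]
  have phase : ∀ γ : Ext α, A γ * R γ⁻¹ = A ⟨γ.proj, 1⟩ * R (⟨γ.proj, 1⟩⁻¹) := by
    intro γ
    have hA' : A γ = (γ.phase : ℂ) • A ⟨γ.proj, 1⟩ := by
      conv_lhs => rw [h1 γ, map_mul, hA, smul_mul_assoc, one_mul]
    have hR' : R γ⁻¹ = (γ.phase : ℂ)⁻¹ • R (⟨γ.proj, 1⟩⁻¹) := by
      conv_lhs => rw [h1 γ, mul_inv_rev, h2, map_mul, hR, mul_smul_comm, mul_one, Circle.coe_inv]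
    rw [hA', hR', smul_mul_smul_comm, mul_inv_cancel₀ (Circle.coe_ne_zero _), one_smul]
  rw [Finset.sum_mul, Finset.mul_sum, ← Equiv.sum_comp (Equiv.mulLeft δ.proj)]
  refine Finset.sum_congr rfl fun k _ => ?_
  have h := phase (δ * ⟨k, 1⟩)
  rw [Ext.mul_proj] at h
  rw [Equiv.coe_mulLeft, ← h, mul_inv_rev, map_mul, map_mul]
  have h4 : R δ⁻¹ * R δ = 1 := by rw [← map_mul, inv_mul_cancel, map_one]
  simp only [mul_assoc, h4, mul_one]

end Averaging

/-- Multiplication by an invertible matrix. -/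
noncomputable def mulVecEquiv {n : ℕ} (N : Matrix (Fin n) (Fin n) ℂ) (h : N.det ≠ 0) :
    (Fin n → ℂ) ≃ₗ[ℂ] (Fin n → ℂ) :=
  LinearEquiv.ofLinearMap (Matrix.mulVecLin N) (Matrix.mulVecLin N⁻¹)
    (by rw [← Matrix.mulVecLin_mul, Matrix.mul_nonsing_inv _ (isUnit_iff_ne_zero.2 h),
      Matrix.mulVecLin_one])
    (by rw [← Matrix.mulVecLin_mul, Matrix.nonsing_inv_mul _ (isUnit_iff_ne_zero.2 h),
      Matrix.mulVecLin_one])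

/-- A trivialization may be modified by a continuous family of invertible matrices. -/
noncomputable def LocalTriv.twist {E : X → Type} [∀ x, AddCommGroup (E x)]
    [∀ x, Module ℂ (E x)] [TopologicalSpace (Tot E)] {U : Set X} {n : ℕ}
    (T : LocalTriv E U (Fin n → ℂ)) (hb : Continuous (Tot.base : Tot E → X))
    (N : U → Matrix (Fin n) (Fin n) ℂ)
    (hN : Continuous N) (hdet : ∀ x, (N x).det ≠ 0) : LocalTriv E U (Fin n → ℂ) where
  chart x := (T.chart x).trans (mulVecEquiv (N x) (hdet x))
  continuous_chart := by
    have h1 : Continuous fun e : {e : Tot E // e.base ∈ U} => (⟨e.1.base, e.2⟩ : U) :=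
      (hb.comp continuous_subtype_val).subtype_mk _
    exact (hN.comp h1).matrix_mulVec T.continuous_chart
  continuous_symm := by
    have h1 : Continuous fun x => (N x)⁻¹ := by
      simp only [Matrix.inv_def, Ring.inverse_eq_inv']
      exact (hN.matrix_det.inv₀ hdet).smul hN.matrix_adjugate
    have h2 : Continuous fun q : U × (Fin n → ℂ) => (N q.1)⁻¹.mulVec q.2 :=
      (h1.comp continuous_fst).matrix_mulVec continuous_snd
    exact T.continuous_symm.comp (continuous_fst.prodMk h2)

namespace TwistedBundle

variable (triv : ∀ (g : G) (x : X), g • x = x) (E : TwistedBundle α X)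

/-- A twisted bundle over a trivial `G`-space is locally isomorphic, equivariantly, to the product
with a fixed representation. -/
theorem exists_equivariant_triv [Finite G] (x₀ : X) : ∃ (U : Set X) (n : ℕ)
    (T : LocalTriv E.fiber U (Fin n → ℂ)) (A : Ext α → (Fin n → ℂ) →ₗ[ℂ] (Fin n → ℂ)),
    IsOpen U ∧ x₀ ∈ U ∧ ∀ (x : U) γ v,
      T.chart x (E.fiberAct triv γ x v) = A γ (T.chart x v) := by
  have := Fintype.ofFinite G
  obtain ⟨U₀, n, hU₀, hx₀, ⟨T₀⟩⟩ := E.locally_trivial x₀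
  let R : U₀ → Ext α →* Module.End ℂ (Fin n → ℂ) := fun x =>
    { toFun := fun γ => (T₀.chart x).toLinearMap ∘ₗ E.fiberAct triv γ x ∘ₗ
        (T₀.chart x).symm.toLinearMap
      map_one' := LinearMap.ext fun v => by simp [E.fiberAct_one triv]
      map_mul' := fun γ δ => by
        refine LinearMap.ext fun v => ?_
        simp [E.fiberAct_mul triv] }
  have hR : ∀ x γ v, R x γ v = T₀.chart x (E.fiberAct triv γ x ((T₀.chart x).symm v)) :=
    fun _ _ _ => rfl
  have hRz : ∀ x (z : Circle), R x ⟨1, z⟩ = (z : ℂ) • 1 := by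
    intro x z
    refine LinearMap.ext fun v => ?_
    rw [hR, E.fiberAct_circle triv]
    simp
  let A := R ⟨x₀, hx₀⟩
  let S : U₀ → Module.End ℂ (Fin n → ℂ) := fun x => ∑ g : G, A ⟨g, 1⟩ * R x (⟨g, 1⟩⁻¹)
  have hS : ∀ x δ, S x * R x δ = A δ * S x := fun x δ =>
    sum_intertwines A (R x) (hRz _) (hRz x) δ
  let N : U₀ → Matrix (Fin n) (Fin n) ℂ := fun x => LinearMap.toMatrix' (S x)
  have hRc : ∀ γ v, Continuous fun x => R x γ v := by
    intro γ v
    simp only [hR]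
    have h1 : Continuous fun x : U₀ => (⟨x, (T₀.chart x).symm v⟩ : Tot E.fiber) :=
      T₀.continuous_symm.comp (continuous_id.prodMk continuous_const)
    exact T₀.continuous_coord (E.continuous_fiberAct triv γ h1) (fun x => x.2)
  have hN : Continuous N := by
    refine continuous_matrix fun i j => ?_
    simp only [N, LinearMap.toMatrix'_apply, S, LinearMap.sum_apply, Module.End.mul_apply,
      Finset.sum_apply]
    refine continuous_finsetSum _ fun g _ => (continuous_apply i).comp ?_
    exact (A ⟨g, 1⟩).continuous_of_finiteDimensional.comp (hRc _ _)
  have hN0 : (N ⟨x₀, hx₀⟩).det ≠ 0 := by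
    have h1 : S ⟨x₀, hx₀⟩ = (Fintype.card G : ℂ) • 1 := by
      have h2 : ∀ g : G, A ⟨g, 1⟩ * R ⟨x₀, hx₀⟩ (⟨g, 1⟩⁻¹) = 1 := fun g => by
        rw [← map_mul, mul_inv_cancel, map_one]
      simp only [S, h2, Finset.sum_const, Finset.card_univ, Nat.cast_smul_eq_nsmul]
    simp only [N, h1, map_smul, LinearMap.toMatrix'_one, Matrix.det_smul, Matrix.det_one, mul_one]
    exact pow_ne_zero _ (Nat.cast_ne_zero.2 Fintype.card_ne_zero)
  let U : Set X := Subtype.val '' {x : U₀ | (N x).det ≠ 0}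
  have hUU : U ⊆ U₀ := by rintro _ ⟨x, _, rfl⟩; exact x.2
  have hUo : IsOpen U :=
    hU₀.isOpenMap_subtype_val _ (isOpen_ne_fun hN.matrix_det continuous_const)
  have hdet : ∀ x : U, (N ⟨x, hUU x.2⟩).det ≠ 0 := by
    rintro ⟨_, ⟨x, hx, rfl⟩⟩; exact hx
  refine ⟨U, n, (T₀.restrict hUU).twist E.continuous_base (fun x => N ⟨x, hUU x.2⟩)
    (hN.comp (by fun_prop)) hdet, A, hUo, ⟨⟨x₀, hx₀⟩, hN0, rfl⟩, fun x γ v => ?_⟩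
  set y : U₀ := ⟨x, hUU x.2⟩
  change (N y).mulVec (T₀.chart y (E.fiberAct triv γ y v)) = A γ ((N y).mulVec (T₀.chart y v))
  have h1 : ∀ w, (N y).mulVec w = S y w := fun w => by
    rw [← Matrix.toLin'_apply, Matrix.toLin'_toMatrix']
  rw [h1, h1]
  have h2 := congrArg (fun L => L (T₀.chart y v)) (hS y γ)
  simpa [hR] using h2

/-- The space of homomorphisms `M → E x` of representations of the extension. -/
def homFiber (M : AlphaRep α) (x : X) : Submodule ℂ (M.V →ₗ[ℂ] E.fiber x) :=
  intertwiners M.extAct fun γ => E.fiberAct triv γ x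

/-- The topology of `Hom(M, E)`: the coarsest one for which the projection and all evaluations
`Hom(M, E) → E` at vectors of `M` are continuous. -/
abbrev homTop (M : AlphaRep α) : TopologicalSpace (Tot fun x => E.homFiber triv M x) :=
  TopologicalSpace.induced
    (fun e => (e.base, fun m : M.V => (⟨e.base, e.vec.1 m⟩ : Tot E.fiber))) inferInstance

attribute [local instance] homTop

theorem continuous_hom_iff (M : AlphaRep α) {Z : Type*} [TopologicalSpace Z]
    {F : Z → Tot fun x => E.homFiber triv M x} :
    Continuous F ↔ (Continuous fun z => (F z).base) ∧ ∀ m : M.V,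
      Continuous fun z => (⟨(F z).base, (F z).vec.1 m⟩ : Tot E.fiber) := by
  rw [continuous_induced_rng]
  exact continuous_prodMk.trans (and_congr Iff.rfl continuous_pi_iff)

/-- The vector bundle `Hom(M, E)` of equivariant homomorphisms from an `α`-representation `M` to a
twisted bundle `E` over a trivial `G`-space. -/
def homBundle [Finite G] (M : AlphaRep α) : CBundle X where
  fiber x := E.homFiber triv M x
  continuous_base := ((E.continuous_hom_iff triv M).1 continuous_id).1
  locally_trivial x₀ := by
    obtain ⟨U, n, T, A, hU, hx, hA⟩ := E.exists_equivariant_triv triv x₀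
    let W₀ : Submodule ℂ (M.V →ₗ[ℂ] (Fin n → ℂ)) := intertwiners M.extAct A
    have : Module.Finite ℂ W₀ := inferInstance
    have : Module.Free ℂ W₀ := Module.Free.of_divisionRing ℂ W₀
    let b := Module.finBasis ℂ W₀
    let c : ∀ x : U, E.homFiber triv M x ≃ₗ[ℂ] W₀ := fun x =>
      { toFun := fun f => ⟨(T.chart x).toLinearMap ∘ₗ f.1, fun γ m => by
          simp [f.2 γ m, hA]⟩
        invFun := fun f => ⟨(T.chart x).symm.toLinearMap ∘ₗ f.1, fun γ m => by
          apply (T.chart x).injective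
          simp [f.2 γ m, hA]⟩
        map_add' := fun f f' => by ext; simp
        map_smul' := fun a f => by ext; simp
        left_inv := fun f => by ext; simp
        right_inv := fun f => by ext; simp }
    have hc := (E.continuous_hom_iff triv M).1 continuous_id
    let bM := Module.finBasis ℂ M.V
    let J : W₀ →ₗ[ℂ] (Fin (Module.finrank ℂ M.V) → Fin n → ℂ) :=
      { toFun := fun f j => f.1 (bM j)
        map_add' := fun f f' => rfl
        map_smul' := fun a f => rfl }
    have hJ : LinearMap.ker J = ⊥ := by
      refine LinearMap.ker_eq_bot'.2 fun f hf => ?_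
      refine Subtype.ext (bM.ext fun j => ?_)
      exact congrFun hf j
    obtain ⟨L, hL⟩ := LinearMap.exists_leftInverse_of_injective (K := ℂ) (V := W₀) J hJ
    have hL' : ∀ w, L (J w) = w := fun w => congrArg (fun K => K w) hL
    refine ⟨U, Module.finrank ℂ W₀, hU, hx, ⟨{
      chart := fun x => (c x).trans b.equivFun
      continuous_chart := ?_
      continuous_symm := ?_ }⟩⟩
    · have h1 : Continuous fun e : {e : Tot fun x => E.homFiber triv M x // e.base ∈ U} =>
          J (c ⟨e.1.base, e.2⟩ e.1.vec) :=
        continuous_pi fun j =>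
          T.continuous_coord ((hc.2 (bM j)).comp continuous_subtype_val) (fun e => e.2)
      have h2 := (b.equivFun.toLinearMap ∘ₗ L).continuous_of_finiteDimensional.comp h1
      refine h2.congr fun e => ?_
      simp [hL']
    · refine (E.continuous_hom_iff triv M).2 ⟨by fun_prop, fun m => ?_⟩
      let ev : (Fin (Module.finrank ℂ W₀) → ℂ) →ₗ[ℂ] (Fin n → ℂ) :=
        LinearMap.applyₗ m ∘ₗ W₀.subtype ∘ₗ b.equivFun.symm.toLinearMap
      have hev := ev.continuous_of_finiteDimensional
      exact T.continuous_symm.comp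
        (f := fun q : U × (Fin (Module.finrank ℂ W₀) → ℂ) => (q.1, ev q.2)) (by fun_prop)

end TwistedBundle

end TrivialAction

/-! ### K-groups -/

section KGroups

variable (X : Type u) [TopologicalSpace X]

instance CBundle.setoid : Setoid (CBundle X) where
  r E E' := Nonempty (CBundle.Iso E E')
  iseqv := ⟨fun M => ⟨.refl M⟩, fun ⟨φ⟩ => ⟨φ.symm⟩, fun ⟨φ⟩ ⟨ψ⟩ => ⟨φ.trans ψ⟩⟩

/-- Isomorphism classes of complex vector bundles. -/
def VectClass := Quotient (CBundle.setoid X)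

instance : Zero (VectClass X) := ⟨Quotient.mk _ (CBundle.zero X)⟩

instance : Add (VectClass X) where
  add := Quotient.map₂ CBundle.sum fun _ _ ⟨φ⟩ _ _ ⟨ψ⟩ => ⟨φ.sumCongr ψ⟩

instance : AddCommMonoid (VectClass X) where
  add_assoc := by
    rintro ⟨M⟩ ⟨N⟩ ⟨P⟩
    exact Quotient.sound ⟨.sumAssoc M N P⟩
  zero_add := by
    rintro ⟨M⟩
    exact Quotient.sound ⟨.zeroSum M⟩
  add_zero := by
    rintro ⟨M⟩
    exact Quotient.sound ⟨(CBundle.Iso.sumComm M _).trans (.zeroSum M)⟩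
  add_comm := by
    rintro ⟨M⟩ ⟨N⟩
    exact Quotient.sound ⟨.sumComm M N⟩
  nsmul := nsmulRec

/-- `K(X)`: the Grothendieck group of complex vector bundles on `X`. -/
abbrev KGroup := Algebra.GrothendieckAddGroup (VectClass X)

/-- The class of a vector bundle in `K(X)`. -/
def CBundle.toK {X : Type u} [TopologicalSpace X] (E : CBundle X) : KGroup X :=
  Algebra.GrothendieckAddGroup.of (Quotient.mk (CBundle.setoid X) E : VectClass X)

variable (α : Cocycle G)

/-- `R_α(G)`: the Grothendieck group of `α`-representations. -/
abbrev RGroup := Algebra.GrothendieckAddGroup (RepClass α)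

/-- The class of an `α`-representation in `R_α(G)`. -/
def AlphaRep.toR {α : Cocycle G} (M : AlphaRep α) : RGroup α :=
  Algebra.GrothendieckAddGroup.of (Quotient.mk (AlphaRep.setoid α) M : RepClass α)

variable [MulAction G X]

/-- Isomorphism classes of `α`-twisted `G`-vector bundles. -/
def TwClass := Quotient (TwistedBundle.setoid α X)

variable [ContinuousConstSMul G X]

instance : Zero (TwClass X α) := ⟨Quotient.mk _ (TwistedBundle.zero α X)⟩

instance : Add (TwClass X α) where
  add := Quotient.map₂ TwistedBundle.sum fun _ _ ⟨φ⟩ _ _ ⟨ψ⟩ => ⟨φ.sumCongr ψ⟩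

instance : AddCommMonoid (TwClass X α) where
  add_assoc := by
    rintro ⟨M⟩ ⟨N⟩ ⟨P⟩
    exact Quotient.sound ⟨.sumAssoc M N P⟩
  zero_add := by
    rintro ⟨M⟩
    exact Quotient.sound ⟨.zeroSum M⟩
  add_zero := by
    rintro ⟨M⟩
    exact Quotient.sound ⟨(TwistedBundle.Iso.sumComm M _).trans (.zeroSum M)⟩
  add_comm := by
    rintro ⟨M⟩ ⟨N⟩
    exact Quotient.sound ⟨.sumComm M N⟩
  nsmul := nsmulRec

/-- `^αK_G(X)`: the Grothendieck group of `α`-twisted `G`-vector bundles on the `G`-space `X`. -/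
abbrev TwistedKGroup := Algebra.GrothendieckAddGroup (TwClass X α)

/-- The class of a twisted bundle in `^αK_G(X)`. -/
def TwistedBundle.toK {X : Type u} [TopologicalSpace X] {α : Cocycle G} [MulAction G X]
    [ContinuousConstSMul G X] (E : TwistedBundle α X) : TwistedKGroup X α :=
  Algebra.GrothendieckAddGroup.of (Quotient.mk (TwistedBundle.setoid α X) E : TwClass X α)

end KGroups

/-! ### The comparison map and functoriality -/

section Maps

variable {α : Cocycle G} {X : Type u} [TopologicalSpace X] [MulAction G X]
  [ContinuousConstSMul G X]

/-- A twisted bundle with zero fibres is isomorphic to the zero bundle. -/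
def TwistedBundle.isoZero (E : TwistedBundle α X) (h : ∀ x, Subsingleton (E.fiber x)) :
    E.Iso (TwistedBundle.zero α X) where
  toEquiv x :=
    have : Subsingleton ((TwistedBundle.zero α X).fiber x) := inferInstanceAs (Subsingleton Unit)
    LinearEquiv.ofLinearMap 0 0 (Subsingleton.elim _ _) (Subsingleton.elim _ _)
  continuous_toFun := (CBundle.zero X).continuous_zero.comp E.continuous_base
  continuous_invFun := E.continuous_zero.comp (CBundle.zero X).continuous_base
  equivariant _ _ _ := rfl

/-- The product of isomorphism classes of vector bundles and of `α`-representations. -/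
noncomputable def tensorClass (triv : ∀ (g : G) (x : X), g • x = x) (α : Cocycle G) :
    VectClass X →+ RepClass α →+ TwClass X α where
  toFun c :=
    { toFun := fun d => Quotient.map₂ (sa := CBundle.setoid X) (sb := AlphaRep.setoid α)
        (sc := TwistedBundle.setoid α X) (tensorTwisted triv)
        (fun _ _ ⟨φ⟩ _ _ ⟨ψ⟩ => ⟨tensorTwistedCongr triv φ ψ⟩) c d
      map_zero' := by
        obtain ⟨E⟩ := c
        exact Quotient.sound ⟨TwistedBundle.isoZero _ fun x =>
          inferInstanceAs (Subsingleton (E.fiber x ⊗[ℂ] Unit))⟩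
      map_add' := by
        obtain ⟨E⟩ := c
        rintro ⟨M⟩ ⟨M'⟩
        exact Quotient.sound ⟨tensorTwistedSumRight triv E M M'⟩ }
  map_zero' := by
    ext d
    obtain ⟨M⟩ := d
    exact Quotient.sound ⟨TwistedBundle.isoZero _ fun x =>
      inferInstanceAs (Subsingleton (Unit ⊗[ℂ] M.V))⟩
  map_add' := by
    rintro ⟨E⟩ ⟨E'⟩
    ext d
    obtain ⟨M⟩ := d
    exact Quotient.sound ⟨tensorTwistedSumLeft triv E E' M⟩

open Algebra (GrothendieckAddGroup)

/-- A homomorphism of commutative monoids induces one of Grothendieck groups. -/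
noncomputable def grothendieckMap {A B : Type*} [AddCommMonoid A] [AddCommMonoid B] (φ : A →+ B) :
    GrothendieckAddGroup A →+ GrothendieckAddGroup B :=
  GrothendieckAddGroup.lift (GrothendieckAddGroup.of.comp φ)

theorem grothendieckLift_of {A B : Type*} [AddCommMonoid A] [AddCommGroup B] (φ : A →+ B) (a : A) :
    GrothendieckAddGroup.lift φ (GrothendieckAddGroup.of a) = φ a :=
  DFunLike.congr_fun (GrothendieckAddGroup.lift.symm_apply_apply φ) a

theorem grothendieckMap_of {A B : Type*} [AddCommMonoid A] [AddCommMonoid B] (φ : A →+ B) (a : A) :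
    grothendieckMap φ (GrothendieckAddGroup.of a) = GrothendieckAddGroup.of (φ a) :=
  grothendieckLift_of _ _

/-- A biadditive map of commutative monoids induces a homomorphism from the tensor product of
their Grothendieck groups. -/
noncomputable def grothendieckTensor {A B C : Type*} [AddCommMonoid A] [AddCommMonoid B]
    [AddCommMonoid C] (φ : A →+ B →+ C) :
    GrothendieckAddGroup A ⊗[ℤ] GrothendieckAddGroup B →+ GrothendieckAddGroup C :=
  TensorProduct.liftAddHom
    (GrothendieckAddGroup.lift
      { toFun := fun a => grothendieckMap (φ a)
        map_zero' := by
          apply GrothendieckAddGroup.lift.symm.injective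
          refine DFunLike.ext _ _ fun b => ?_
          change grothendieckMap (φ 0) (GrothendieckAddGroup.of b) = 0
          rw [grothendieckMap_of, map_zero, AddMonoidHom.zero_apply, map_zero]
        map_add' := fun a a' => by
          apply GrothendieckAddGroup.lift.symm.injective
          refine DFunLike.ext _ _ fun b => ?_
          change grothendieckMap (φ (a + a')) (GrothendieckAddGroup.of b) =
            grothendieckMap (φ a) (GrothendieckAddGroup.of b) +
              grothendieckMap (φ a') (GrothendieckAddGroup.of b)
          simp only [grothendieckMap_of, map_add, AddMonoidHom.add_apply] })
    (fun r m n => by simp)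

theorem grothendieckTensor_of {A B C : Type*} [AddCommMonoid A] [AddCommMonoid B]
    [AddCommMonoid C] (φ : A →+ B →+ C) (a : A) (b : B) :
    grothendieckTensor φ (GrothendieckAddGroup.of a ⊗ₜ GrothendieckAddGroup.of b) =
      GrothendieckAddGroup.of (φ a b) := by
  rw [grothendieckTensor, TensorProduct.liftAddHom_tmul, grothendieckLift_of]
  exact grothendieckLift_of _ _

/-- The natural map `K(X) ⊗ R_α(G) → ^αK_G(X)` for a trivial `G`-space `X`, determined by
`[E] ⊗ [M] ↦ [E ⊗ M]`. -/
noncomputable def tensorMap (triv : ∀ (g : G) (x : X), g • x = x) (α : Cocycle G) :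
    KGroup X ⊗[ℤ] RGroup α →+ TwistedKGroup X α :=
  grothendieckTensor (tensorClass triv α)

theorem tensorMap_tmul (triv : ∀ (g : G) (x : X), g • x = x) (E : CBundle X) (M : AlphaRep α) :
    tensorMap triv α (E.toK ⊗ₜ M.toR) = (tensorTwisted triv E M).toK :=
  grothendieckTensor_of _ _ _

section Functoriality

/-- The homomorphism `f^* : K(Y) → K(X)` induced by a continuous map `f : X → Y`. -/
noncomputable def KGroup.pullback {X : Type u} [TopologicalSpace X] {Y : Type w}
    [TopologicalSpace Y] (f : C(X, Y)) : KGroup Y →+ KGroup X :=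
  grothendieckMap
    { toFun := Quotient.map (fun E => E.pullback f) fun _ _ ⟨φ⟩ => ⟨φ.pullback f⟩
      map_zero' := Quotient.sound ⟨.pullbackZero f⟩
      map_add' := by
        rintro ⟨E⟩ ⟨E'⟩
        exact Quotient.sound ⟨.pullbackSum f E E'⟩ }

variable {G' : Type w} [Group G'] {β : Cocycle G'} (h : G →* G')

/-- The homomorphism `h^* : R_β(G') → R_{h^*β}(G)` induced by a homomorphism `h : G → G'`. -/
noncomputable def RGroup.comap : RGroup β →+ RGroup (β.comap h) :=
  grothendieckMap
    { toFun := Quotient.map (fun M => M.comap h) fun _ _ ⟨φ⟩ =>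
        ⟨⟨φ.toEquiv, fun g v => φ.map_ρ (h g) v⟩⟩
      map_zero' := Quotient.sound ⟨⟨LinearEquiv.refl ℂ _, fun _ _ => rfl⟩⟩
      map_add' := by
        rintro ⟨M⟩ ⟨M'⟩
        exact Quotient.sound ⟨⟨LinearEquiv.refl ℂ _, fun _ _ => rfl⟩⟩ }

variable {Y : Type*} [TopologicalSpace Y] [MulAction G' Y] [ContinuousConstSMul G' Y]
  (f : C(X, Y)) (hf : ∀ (g : G) (x : X), f (g • x) = h g • f x)

theorem CBundle.Iso.map_castFiber {X : Type u} [TopologicalSpace X] {E E' : CBundle X}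
    (φ : E.Iso E') {x y : X} (hxy : x = y) (v : E.fiber x) :
    φ.toEquiv y (E.castFiber hxy v) = E'.castFiber hxy (φ.toEquiv x v) := by
  subst hxy; rfl

theorem CBundle.castFiber_sum {X : Type u} [TopologicalSpace X] (E E' : CBundle X) {x y : X}
    (hxy : x = y) (v : (E.sum E').fiber x) :
    (E.sum E').castFiber hxy v = (E.castFiber hxy v.1, E'.castFiber hxy v.2) := by
  subst hxy; rfl

def TwistedBundle.Iso.pullback {E E' : TwistedBundle β Y} (φ : E.Iso E') :
    (E.pullback h f hf).Iso (E'.pullback h f hf) where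
  toIso := φ.toIso.pullback f
  equivariant γ x v := by
    refine (φ.toIso.map_castFiber (hf γ.proj x).symm _).trans ?_
    exact congrArg (E'.castFiber (hf γ.proj x).symm) (φ.equivariant (Ext.map h γ) (f x) v)

def TwistedBundle.Iso.pullbackSum (E E' : TwistedBundle β Y) :
    ((E.sum E').pullback h f hf).Iso ((E.pullback h f hf).sum (E'.pullback h f hf)) where
  toIso := CBundle.Iso.pullbackSum f _ _
  equivariant γ x _ := CBundle.castFiber_sum E.toCBundle E'.toCBundle (hf γ.proj x).symm _

/-- The homomorphism `^βK_{G'}(Y) → ^{h^*β}K_G(X)` induced by a map `f : X → Y` which is equivariant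
with respect to the homomorphism `h : G → G'`. -/
noncomputable def TwistedKGroup.pullback : TwistedKGroup Y β →+ TwistedKGroup X (β.comap h) :=
  grothendieckMap
    { toFun := Quotient.map (fun E => E.pullback h f hf) fun _ _ ⟨φ⟩ => ⟨φ.pullback h f hf⟩
      map_zero' := Quotient.sound ⟨TwistedBundle.isoZero _ fun _ =>
        inferInstanceAs (Subsingleton Unit)⟩
      map_add' := by
        rintro ⟨E⟩ ⟨E'⟩
        exact Quotient.sound ⟨.pullbackSum h f hf E E'⟩ }

end Functoriality

end Maps

end Twisted

end TwistedK

/-!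
Over a trivial `G`-space `X` every fibre of a twisted bundle is an `α`-representation, so the theorem
is the isotypic decomposition of `α`-representations carried out in families.

*Representations.* Averaging over `G` gives Maschke's theorem (`AlphaRep.exists_isCompl`), since the
scalars `α(h, g)` cancel when a projection is conjugated. Hence every property stable under
isomorphism and direct sums can be checked on irreducible representations (`AlphaRep.induction_on`).
Every irreducible representation is a quotient of the twisted regular one, and a given representation
has only finitely many irreducible quotients, so there are finitely many irreducible representations
`M i` (`AlphaRep.exists_isCompleteIrr`). Evaluation `⨁ i, Hom(M i, N) ⊗ M i → N` is bijective for
every `N` (`AlphaRep.bijective_sum_evalMaps`): the images of the `M i` span `N`, and the dimensions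
agree by Schur's lemma.

*Bundles.* A bundle map which is bijective on the fibres is an isomorphism
(`CBundle.Iso.ofBijective`). Applied to fibrewise evaluation, this shows that
`⨁ i, Hom(M i, E) ⊗ M i → E` is an isomorphism of twisted bundles
(`TwistedBundle.cls_eq_sum_tensorClass`), so that `[E] ↦ ∑ i, [Hom(M i, E)] ⊗ [M i]` is a right
inverse of the comparison map. Applied to the coevaluation `E → Hom(M, E ⊗ M)`, it shows together
with Schur's lemma that `Hom(M i, E ⊗ M j)` is `E` for `i = j` and zero otherwise. As the classes
`[M j]` generate `R_α(G)`, the same map is a left inverse (`isotypicMap_tensorMap`).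

*Naturality* is checked on the generators `[E] ⊗ [M]`, for which `f^* E ⊗ h^* M` and the pullback of
`E ⊗ M` have the same fibres, topology and action (`pullbackTensorTwisted`).
-/

namespace TwistedK

universe u v

/-! ### Schur's lemma and complete reducibility of `α`-representations -/

section Representations

variable {G : Type v} [Group G] {α : Cocycle G}

namespace AlphaRep

/-- The isomorphism class of an `α`-representation. -/
def cls (M : AlphaRep α) : RepClass α := Quotient.mk (AlphaRep.setoid α) M

theorem cls_eq_iff {M N : AlphaRep α} : M.cls = N.cls ↔ Nonempty (Iso M N) := Quotient.eq

/-- An `α`-representation given by endomorphisms; the relations force them to be invertible. -/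
noncomputable def ofEnd (V : Type) [AddCommGroup V] [Module ℂ V] [FiniteDimensional ℂ V]
    (ρ : G → V →ₗ[ℂ] V) (h1 : ∀ v, ρ 1 v = v)
    (hm : ∀ g h v, ρ g (ρ h v) = (α.toFun g h : ℂ) • ρ (g * h) v) : AlphaRep α where
  V := V
  ρ g := LinearEquiv.ofInjectiveEndo (ρ g) <| by
    refine (injective_iff_map_eq_zero _).2 fun v hv => ?_
    have h := hm g⁻¹ g v
    rw [hv, map_zero, inv_mul_cancel, h1] at h
    exact (smul_eq_zero.1 h.symm).resolve_left (Circle.coe_ne_zero _)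
  map_one v := h1 v
  map_mul g h v := hm g h v

/-- The space of homomorphisms `M → N` of `α`-representations. -/
abbrev homs (M N : AlphaRep α) : Submodule ℂ (M.V →ₗ[ℂ] N.V) := intertwiners M.extAct N.extAct

theorem mem_homs {M N : AlphaRep α} {f : M.V →ₗ[ℂ] N.V} :
    f ∈ homs M N ↔ ∀ g v, f (M.ρ g v) = N.ρ g (f v) := by
  refine ⟨fun h g v => ?_, fun h γ v => ?_⟩
  · simpa [extAct_apply] using h ⟨g, 1⟩ v
  · simp [extAct_apply, h]

theorem map_ρ_of_mem {M N : AlphaRep α} {f : M.V →ₗ[ℂ] N.V} (hf : f ∈ homs M N) (g : G) (v : M.V) :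
    f (M.ρ g v) = N.ρ g (f v) :=
  mem_homs.1 hf g v

theorem comp_mem_homs {M N P : AlphaRep α} {f : N.V →ₗ[ℂ] P.V} {f' : M.V →ₗ[ℂ] N.V}
    (hf : f ∈ homs N P) (hf' : f' ∈ homs M N) : f ∘ₗ f' ∈ homs M P :=
  fun γ v => (congrArg f (hf' γ v)).trans (hf γ _)

theorem Iso.mem_homs {M N : AlphaRep α} (φ : Iso M N) : φ.toEquiv.toLinearMap ∈ homs M N :=
  φ.map_extAct

theorem inl_mem_homs (M N : AlphaRep α) : LinearMap.inl ℂ M.V N.V ∈ homs M (M.sum N) :=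
  AlphaRep.mem_homs.2 fun g _ => Prod.ext rfl (map_zero (N.ρ g)).symm

theorem inr_mem_homs (M N : AlphaRep α) : LinearMap.inr ℂ M.V N.V ∈ homs N (M.sum N) :=
  AlphaRep.mem_homs.2 fun g _ => Prod.ext (map_zero (M.ρ g)).symm rfl

theorem fst_mem_homs (M N : AlphaRep α) : LinearMap.fst ℂ M.V N.V ∈ homs (M.sum N) M :=
  AlphaRep.mem_homs.2 fun _ _ => rfl

theorem snd_mem_homs (M N : AlphaRep α) : LinearMap.snd ℂ M.V N.V ∈ homs (M.sum N) N :=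
  AlphaRep.mem_homs.2 fun _ _ => rfl

/-- A bijective homomorphism is an isomorphism. -/
noncomputable def Iso.ofBijective {M N : AlphaRep α} (f : M.V →ₗ[ℂ] N.V) (hf : f ∈ homs M N)
    (hb : Function.Bijective f) : Iso M N where
  toEquiv := LinearEquiv.ofBijective f hb
  map_ρ := map_ρ_of_mem hf

/-- The subrepresentation on an invariant subspace. -/
noncomputable def sub (M : AlphaRep α) (W : Submodule ℂ M.V) (hW : ∀ g, ∀ v ∈ W, M.ρ g v ∈ W) :
    AlphaRep α :=
  ofEnd W (fun g => (M.ρ g).toLinearMap.restrict (hW g))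
    (fun v => Subtype.ext (M.map_one v)) (fun g h v => Subtype.ext (M.map_mul g h v))

/-- Half of Schur's lemma: a nonzero homomorphism of irreducible representations is bijective. -/
theorem bijective_of_ne_zero {M N : AlphaRep α} (hM : M.IsIrreducible) (hN : N.IsIrreducible)
    {f : M.V →ₗ[ℂ] N.V} (hf : f ∈ homs M N) (h0 : f ≠ 0) : Function.Bijective f := by
  constructor
  · rw [← LinearMap.ker_eq_bot]
    refine (hM.2 (LinearMap.ker f) fun g v hv => ?_).resolve_right fun h => h0 ?_
    · rw [LinearMap.mem_ker, map_ρ_of_mem hf, LinearMap.mem_ker.1 hv, map_zero]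
    · exact LinearMap.ker_eq_top.1 h
  · rw [← LinearMap.range_eq_top]
    refine (hN.2 (LinearMap.range f) ?_).resolve_left fun h => h0 (LinearMap.range_eq_bot.1 h)
    rintro g _ ⟨v, rfl⟩
    exact ⟨M.ρ g v, map_ρ_of_mem hf g v⟩

/-- The other half of Schur's lemma: endomorphisms of an irreducible representation are scalars. -/
theorem exists_eq_smul {M : AlphaRep α} (hM : M.IsIrreducible) {f : M.V →ₗ[ℂ] M.V}
    (hf : f ∈ homs M M) : ∃ c : ℂ, ∀ v, f v = c • v := by
  have := hM.1
  obtain ⟨c, hc⟩ := Module.End.exists_eigenvalue f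
  refine ⟨c, fun v => ?_⟩
  have h := (hM.2 (Module.End.eigenspace f c) fun g v hv => ?_).resolve_left hc
  · exact Module.End.mem_eigenspace_iff.1 (h ▸ Submodule.mem_top)
  · rw [Module.End.mem_eigenspace_iff] at hv ⊢
    rw [map_ρ_of_mem hf, hv, map_smul]

/-- Maschke's theorem: the average of the conjugates of a projection onto `W` is an equivariant
projection, whose kernel is the complement. -/
theorem exists_isCompl [Finite G] (M : AlphaRep α) (W : Submodule ℂ M.V)
    (hW : ∀ g, ∀ v ∈ W, M.ρ g v ∈ W) :
    ∃ W' : Submodule ℂ M.V, (∀ g, ∀ v ∈ W', M.ρ g v ∈ W') ∧ IsCompl W W' := by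
  have := Fintype.ofFinite G
  have hinv : ∀ g, ∀ v ∈ W, (M.ρ g).symm v ∈ W := by
    intro g v hv
    have h := M.map_mul g⁻¹ g ((M.ρ g).symm v)
    rw [LinearEquiv.apply_symm_apply, inv_mul_cancel, M.map_one] at h
    have h2 := W.smul_mem (α.toFun g⁻¹ g : ℂ)⁻¹ (hW g⁻¹ v hv)
    rwa [h, smul_smul, inv_mul_cancel₀ (Circle.coe_ne_zero _), one_smul] at h2
  obtain ⟨p, hp⟩ := LinearMap.exists_leftInverse_of_injective W.subtype W.ker_subtype
  have hpW : ∀ w : W, p w = w := fun w => congrArg (fun L => L w) hp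
  let P : M.V →ₗ[ℂ] M.V :=
    ∑ g, (M.ρ g).toLinearMap ∘ₗ W.subtype ∘ₗ p ∘ₗ (M.ρ g).symm.toLinearMap
  have hP : ∀ v, P v = ∑ g, M.ρ g (p ((M.ρ g).symm v)) := fun v => by
    simp [P, LinearMap.sum_apply]
  have hPmem : ∀ v, P v ∈ W := fun v => by
    rw [hP]
    exact Submodule.sum_mem _ fun g _ => hW g _ (p _).2
  have hPW : ∀ w ∈ W, P w = (Fintype.card G : ℂ) • w := by
    intro w hw
    rw [hP]
    have h : ∀ g, M.ρ g (p ((M.ρ g).symm w)) = w := fun g => by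
      rw [hpW ⟨_, hinv g w hw⟩, LinearEquiv.apply_symm_apply]
    simp only [h, Finset.sum_const, Finset.card_univ, Nat.cast_smul_eq_nsmul]
  have hPρ : ∀ h v, P (M.ρ h v) = M.ρ h (P v) := by
    intro h v
    rw [hP, hP, map_sum, ← Equiv.sum_comp (Equiv.mulLeft h)]
    refine Finset.sum_congr rfl fun g _ => ?_
    -- the scalars `α(h, g)` coming from `ρ(h g)` and from its inverse cancel
    have h1 : (M.ρ (h * g)).symm (M.ρ h v) = (α.toFun h g : ℂ) • (M.ρ g).symm v := by
      rw [LinearEquiv.symm_apply_eq, map_smul, ← M.map_mul, LinearEquiv.apply_symm_apply]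
    rw [Equiv.coe_mulLeft, h1, map_smul, Submodule.coe_smul, map_smul, ← M.map_mul]
  have hcard : (Fintype.card G : ℂ) ≠ 0 := Nat.cast_ne_zero.2 Fintype.card_ne_zero
  let f : M.V →ₗ[ℂ] W := (Fintype.card G : ℂ)⁻¹ • P.codRestrict W hPmem
  have hf : ∀ v, v ∈ LinearMap.ker f ↔ P v = 0 := fun v => by
    rw [LinearMap.mem_ker, LinearMap.smul_apply, smul_eq_zero_iff_right (inv_ne_zero hcard),
      ← Subtype.coe_inj]
    rfl
  refine ⟨LinearMap.ker f, fun g v hv => ?_, LinearMap.isCompl_of_proj fun w => ?_⟩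
  · rw [hf] at hv ⊢
    rw [hPρ, hv, map_zero]
  · refine Subtype.ext ?_
    change (Fintype.card G : ℂ)⁻¹ • P w = w
    rw [hPW w w.2, smul_smul, inv_mul_cancel₀ hcard, one_smul]

/-- A property of `α`-representations which is invariant under isomorphism and direct sums and holds
for zero and for irreducible representations holds for all of them. -/
theorem induction_on [Finite G] {P : AlphaRep α → Prop}
    (iso : ∀ M N, Iso M N → P M → P N) (zero : ∀ M : AlphaRep α, Subsingleton M.V → P M)
    (irr : ∀ M : AlphaRep α, M.IsIrreducible → P M) (sum : ∀ M N, P M → P N → P (M.sum N))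
    (M : AlphaRep α) : P M := by
  induction h : Module.finrank ℂ M.V using Nat.strong_induction_on generalizing M with
  | _ d ih =>
    rcases subsingleton_or_nontrivial M.V with h0 | h0
    · exact zero M h0
    by_cases hirr : M.IsIrreducible
    · exact irr M hirr
    have hW : ∃ W : Submodule ℂ M.V, (∀ g, ∀ v ∈ W, M.ρ g v ∈ W) ∧ W ≠ ⊥ ∧ W ≠ ⊤ := by
      by_contra! hc
      refine hirr ⟨h0, fun W hW => ?_⟩
      by_contra! hW'
      exact hW'.2 (hc W hW hW'.1)
    obtain ⟨W, hW, hbot, htop⟩ := hW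
    obtain ⟨W', hW', hc⟩ := M.exists_isCompl W hW
    have hd := Submodule.finrank_add_eq_of_isCompl hc
    have h1 : 0 < Module.finrank ℂ W := Submodule.one_le_finrank_iff.2 hbot
    have h2 : Module.finrank ℂ W < Module.finrank ℂ M.V := Submodule.finrank_lt htop
    have h3 : Module.finrank ℂ W' < Module.finrank ℂ M.V := by omega
    refine iso ((M.sub W hW).sum (M.sub W' hW')) M
      ⟨Submodule.prodEquivOfIsCompl W W' hc, fun g v => ?_⟩
      (sum _ _ (ih _ (h ▸ h2) (M.sub W hW) rfl) (ih _ (h ▸ h3) (M.sub W' hW') rfl))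
    exact (map_add (M.ρ g) (W.subtype v.1) (W'.subtype v.2)).symm

/-! ### Finiteness of the set of irreducible representations -/

/-- The regular `α`-representation, on functions on `G`. The functions are defined on a copy of `G`
in the lowest universe, where `α`-representations live. -/
noncomputable def regular [Finite G] (α : Cocycle G) : AlphaRep α :=
  ofEnd (Shrink.{0} G → ℂ)
    (fun g =>
      { toFun := fun φ k => (α.toFun g (g⁻¹ * (equivShrink.{0} G).symm k) : ℂ) *
          φ (equivShrink.{0} G (g⁻¹ * (equivShrink.{0} G).symm k))
        map_add' := fun φ ψ => by ext k; simp [mul_add]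
        map_smul' := fun c φ => by ext k; simp [mul_left_comm] })
    (fun φ => by ext k; simp [α.one_left])
    (fun g h φ => by
      ext k
      have hc := congrArg (fun z : Circle => (z : ℂ))
        (α.cocycle g h (h⁻¹ * (g⁻¹ * (equivShrink.{0} G).symm k)))
      simp only [mul_inv_cancel_left, Circle.coe_mul] at hc
      simp only [LinearMap.coe_mk, AddHom.coe_mk, Equiv.symm_apply_apply, Pi.smul_apply,
        smul_eq_mul, mul_inv_rev, mul_assoc]
      rw [← mul_assoc, ← hc, mul_assoc])

theorem regular_ρ_apply_mul [Finite G] (g k : G) (φ : Shrink.{0} G → ℂ) :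
    ((regular α).ρ g φ : Shrink.{0} G → ℂ) (equivShrink.{0} G (g * k)) =
      (α.toFun g k : ℂ) * φ (equivShrink.{0} G k) := by
  change (α.toFun g (g⁻¹ * (equivShrink.{0} G).symm (equivShrink.{0} G (g * k))) : ℂ) *
    φ (equivShrink.{0} G (g⁻¹ * (equivShrink.{0} G).symm (equivShrink.{0} G (g * k)))) = _
  simp

/-- Every nonzero representation receives a nonzero homomorphism from the regular one. -/
theorem exists_hom_regular [Finite G] (N : AlphaRep α) (hN : Nontrivial N.V) :
    ∃ f ∈ homs (regular α) N, f ≠ 0 := by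
  have := Fintype.ofFinite G
  obtain ⟨w, hw⟩ := exists_ne (0 : N.V)
  let f : (Shrink.{0} G → ℂ) →ₗ[ℂ] N.V :=
    ∑ g : G, (LinearMap.proj (equivShrink.{0} G g)).smulRight (N.ρ g w)
  have hf : ∀ φ, f φ = ∑ g : G, φ (equivShrink.{0} G g) • N.ρ g w := fun φ => by
    simp [f, LinearMap.sum_apply]
  refine ⟨f, mem_homs.2 fun g φ => ?_, fun h => hw ?_⟩
  · refine (hf _).trans (Eq.trans ?_ (congrArg (N.ρ g) (hf φ)).symm)
    rw [map_sum, ← Equiv.sum_comp (Equiv.mulLeft g)]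
    refine Finset.sum_congr rfl fun k _ => ?_
    refine (congrArg (fun c : ℂ => c • N.ρ (g * k) w) (regular_ρ_apply_mul g k φ)).trans ?_
    rw [map_smul, N.map_mul, smul_smul, mul_comm]
  · classical
    have h1 : f (Pi.single (equivShrink.{0} G 1) 1) = 0 :=
      congrArg (fun L : (Shrink.{0} G → ℂ) →ₗ[ℂ] N.V => L (Pi.single (equivShrink.{0} G 1) 1)) h
    rw [hf, Finset.sum_eq_single 1 (fun g _ hg => ?_) (by simp)] at h1
    · simpa [N.map_one] using h1
    · rw [Pi.single_eq_of_ne (by simpa using hg), zero_smul]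

/-- Up to isomorphism, only finitely many irreducible representations receive a nonzero homomorphism
from a given representation. -/
theorem finite_quotients [Finite G] (M : AlphaRep α) :
    {c : RepClass α | ∃ N : AlphaRep α, N.IsIrreducible ∧ (∃ f ∈ homs M N, f ≠ 0) ∧
      N.cls = c}.Finite := by
  induction M using induction_on with
  | iso M M' φ h =>
    refine h.subset ?_
    rintro _ ⟨N, hN, ⟨f, hf, h0⟩, rfl⟩
    refine ⟨N, hN, ⟨_, comp_mem_homs hf φ.mem_homs, fun h => h0 ?_⟩, rfl⟩
    ext v
    simpa using congrArg (fun L => L (φ.toEquiv.symm v)) h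
  | zero M h =>
    convert Set.finite_empty
    refine Set.eq_empty_of_forall_notMem ?_
    rintro _ ⟨N, hN, ⟨f, hf, h0⟩, rfl⟩
    exact h0 (LinearMap.ext fun v => by rw [Subsingleton.elim v 0, map_zero, map_zero])
  | irr M h =>
    refine (Set.finite_singleton M.cls).subset ?_
    rintro _ ⟨N, hN, ⟨f, hf, h0⟩, rfl⟩
    exact cls_eq_iff.2 ⟨(Iso.ofBijective f hf (bijective_of_ne_zero h hN hf h0)).symm⟩
  | sum M M' h h' =>
    refine (h.union h').subset ?_
    rintro _ ⟨N, hN, ⟨f, hf, h0⟩, rfl⟩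
    by_cases h1 : f ∘ₗ LinearMap.inl ℂ M.V M'.V = 0
    · exact Or.inr ⟨N, hN, ⟨_, comp_mem_homs hf (inr_mem_homs M M'),
        fun h2 => h0 (LinearMap.prod_ext h1 h2)⟩, rfl⟩
    · exact Or.inl ⟨N, hN, ⟨_, comp_mem_homs hf (inl_mem_homs M M'), h1⟩, rfl⟩

/-- There are finitely many irreducible representations: all of them are quotients of the regular
one. -/
theorem exists_isCompleteIrr [Finite G] (α : Cocycle G) :
    ∃ (n : ℕ) (M : Fin n → AlphaRep α), IsCompleteIrr M := by
  let S : Set (RepClass α) := {c | ∃ N : AlphaRep α, N.IsIrreducible ∧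
    (∃ f ∈ homs (regular α) N, f ≠ 0) ∧ N.cls = c}
  have : Finite S := (finite_quotients (regular α)).to_subtype
  let e := Finite.equivFin S
  choose R hirr _ hR using fun c : S => c.2
  refine ⟨_, fun i => R (e.symm i), fun i => hirr _, fun i j hij => ?_, fun N hN => ?_⟩
  · refine e.symm.injective (Subtype.ext ?_)
    rw [← hR (e.symm i), ← hR (e.symm j)]
    exact cls_eq_iff.2 hij
  · let c : S := ⟨_, N, hN, exists_hom_regular N hN.1, rfl⟩
    refine ⟨e c, ?_⟩
    change Nonempty (N.Iso (R (e.symm (e c))))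
    rw [Equiv.symm_apply_apply]
    exact cls_eq_iff.1 (hR c).symm

end AlphaRep
end Representations

/-! ### The isotypic decomposition of an `α`-representation -/

section Isotypic

variable {G : Type v} [Group G] {α : Cocycle G}

namespace AlphaRep

/-- `Hom(M, N) ≅ Hom(M, N')` for `N ≅ N'`. -/
def homsCongr (M : AlphaRep α) {N N' : AlphaRep α} (φ : Iso N N') : homs M N ≃ₗ[ℂ] homs M N' where
  toFun f := ⟨_, comp_mem_homs φ.mem_homs f.2⟩
  invFun f := ⟨_, comp_mem_homs φ.symm.mem_homs f.2⟩
  map_add' _ _ := Subtype.ext (LinearMap.comp_add _ _ _)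
  map_smul' _ _ := Subtype.ext (LinearMap.comp_smul _ _ _)
  left_inv f := Subtype.ext <| LinearMap.ext fun v => φ.toEquiv.symm_apply_apply (f.1 v)
  right_inv f := Subtype.ext <| LinearMap.ext fun v => φ.toEquiv.apply_symm_apply (f.1 v)

/-- `Hom(M, N ⊕ N') ≅ Hom(M, N) ⊕ Hom(M, N')`. -/
def homsSum (M N N' : AlphaRep α) : homs M (N.sum N') ≃ₗ[ℂ] homs M N × homs M N' where
  toFun f := (⟨_, comp_mem_homs (fst_mem_homs N N') f.2⟩,
    ⟨_, comp_mem_homs (snd_mem_homs N N') f.2⟩)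
  invFun f := ⟨f.1.1.prod f.2.1, fun γ v => Prod.ext (f.1.2 γ v) (f.2.2 γ v)⟩
  map_add' _ _ := rfl
  map_smul' _ _ := rfl
  left_inv _ := rfl
  right_inv _ := rfl

theorem finrank_homs_irreducible {M N : AlphaRep α}
    (hM : M.IsIrreducible) (hN : N.IsIrreducible) [Decidable (Nonempty (Iso M N))] :
    Module.finrank ℂ (homs M N) = if Nonempty (Iso M N) then 1 else 0 := by
  split_ifs with h
  · obtain ⟨φ⟩ := h
    have := hM.1
    rw [← (homsCongr M φ).finrank_eq]
    refine finrank_eq_one (⟨LinearMap.id, fun _ _ => rfl⟩ : homs M M) (fun h => ?_) fun f => ?_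
    · obtain ⟨v, hv⟩ := exists_ne (0 : M.V)
      exact hv (congrArg (fun f : homs M M => f.1 v) h)
    · obtain ⟨c, hc⟩ := exists_eq_smul hM f.2
      exact ⟨c, Subtype.ext (LinearMap.ext fun v => (hc v).symm)⟩
  · have : Subsingleton (homs M N) := by
      refine subsingleton_of_forall_eq 0 fun f => ?_
      by_contra hf
      exact h ⟨Iso.ofBijective f.1 f.2 (bijective_of_ne_zero hM hN f.2
        fun h0 => hf (Subtype.ext h0))⟩
    exact Module.finrank_zero_of_subsingleton

variable {n : ℕ} {M : Fin n → AlphaRep α}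

/-- The dimension formula underlying the isotypic decomposition. -/
theorem sum_finrank_homs_mul [Finite G] (hM : IsCompleteIrr M) (N : AlphaRep α) :
    ∑ i, Module.finrank ℂ (homs (M i) N) * Module.finrank ℂ (M i).V = Module.finrank ℂ N.V := by
  classical
  induction N using induction_on with
  | iso N N' φ h =>
    rw [← φ.toEquiv.finrank_eq, ← h]
    exact Finset.sum_congr rfl fun i _ => by rw [(homsCongr (M i) φ).finrank_eq]
  | zero N h =>
    have h' : ∀ i, Subsingleton (homs (M i) N) := fun i =>
      ⟨fun f f' => Subtype.ext (LinearMap.ext fun v => Subsingleton.elim _ _)⟩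
    simp [Module.finrank_zero_of_subsingleton]
  | irr N h =>
    obtain ⟨j, ⟨φ⟩⟩ := hM.2.2 N h
    rw [φ.toEquiv.finrank_eq, Finset.sum_eq_single j (fun i _ hij => ?_) (by simp),
      finrank_homs_irreducible (hM.1 j) h, if_pos ⟨φ.symm⟩, one_mul]
    rw [finrank_homs_irreducible (hM.1 i) h, if_neg, zero_mul]
    rintro ⟨ψ⟩
    exact hij (hM.2.1 i j ⟨ψ.trans φ⟩)
  | sum N N' h h' =>
    have h2 : Module.finrank ℂ (N.sum N').V = _ :=
      Module.finrank_prod (R := ℂ) (M := N.V) (M' := N'.V)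
    rw [h2, ← h, ← h', ← Finset.sum_add_distrib]
    exact Finset.sum_congr rfl fun i _ => by
      rw [(homsSum (M i) N N').finrank_eq, Module.finrank_prod, add_mul]

/-- The images of the irreducible representations span every representation. -/
theorem span_homs [Finite G] (hM : IsCompleteIrr M) (N : AlphaRep α) :
    Submodule.span ℂ {v : N.V | ∃ i, ∃ f ∈ homs (M i) N, ∃ m, f m = v} = ⊤ := by
  have map : ∀ {N N' : AlphaRep α} {φ : N.V →ₗ[ℂ] N'.V}, φ ∈ homs N N' →
      Submodule.span ℂ {v : N.V | ∃ i, ∃ f ∈ homs (M i) N, ∃ m, f m = v} = ⊤ →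
      LinearMap.range φ ≤
        Submodule.span ℂ {v : N'.V | ∃ i, ∃ f ∈ homs (M i) N', ∃ m, f m = v} := by
    intro N N' φ hφ h
    rw [LinearMap.range_eq_map, ← h, Submodule.map_span]
    refine Submodule.span_mono ?_
    rintro _ ⟨_, ⟨i, f, hf, m, rfl⟩, rfl⟩
    exact ⟨i, _, comp_mem_homs hφ hf, m, rfl⟩
  induction N using induction_on with
  | iso N N' φ h =>
    have h1 := map φ.mem_homs h
    rwa [LinearEquiv.range, top_le_iff] at h1
  | zero N h => exact Subsingleton.elim _ _
  | irr N h =>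
    obtain ⟨j, ⟨φ⟩⟩ := hM.2.2 N h
    refine top_le_iff.1 fun v _ => Submodule.subset_span ?_
    exact ⟨j, _, φ.symm.mem_homs, φ.toEquiv v, φ.toEquiv.symm_apply_apply v⟩
  | sum N N' h h' =>
    refine top_le_iff.1 (LinearMap.sup_range_inl_inr.ge.trans ?_)
    exact sup_le (map (inl_mem_homs N N') h) (map (inr_mem_homs N N') h')

/-- Evaluation of the linear maps in a space `H` of linear maps `V → W` at vectors of `V`. -/
noncomputable def evalMaps {V W : Type} [AddCommGroup V] [Module ℂ V] [AddCommGroup W] [Module ℂ W]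
    (H : Submodule ℂ (V →ₗ[ℂ] W)) : H ⊗[ℂ] V →ₗ[ℂ] W :=
  TensorProduct.lift H.subtype

@[simp]
theorem evalMaps_tmul {V W : Type} [AddCommGroup V] [Module ℂ V] [AddCommGroup W] [Module ℂ W]
    (H : Submodule ℂ (V →ₗ[ℂ] W)) (f : H) (v : V) : evalMaps H (f ⊗ₜ v) = f.1 v :=
  rfl

theorem evalMaps_eq_sum {ι V W : Type} [Fintype ι] [AddCommGroup V] [Module ℂ V] [AddCommGroup W]
    [Module ℂ W] (b : Module.Basis ι ℂ V) (H : Submodule ℂ (V →ₗ[ℂ] W)) (t : H ⊗[ℂ] V) :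
    evalMaps H t = ∑ k, (CBundle.contr H (b.coord k) t).1 (b k) := by
  induction t using TensorProduct.induction_on with
  | zero => simp
  | tmul f v =>
    conv_lhs => rw [evalMaps_tmul, ← b.sum_repr v, map_sum]
    simp
  | add s t hs ht => simp [hs, ht, Finset.sum_add_distrib]

/-- A representation is the direct sum of its isotypic parts `Hom(M i, N) ⊗ M i`. -/
theorem bijective_sum_evalMaps [Finite G] (hM : IsCompleteIrr M) (N : AlphaRep α)
    (H : ∀ i, Submodule ℂ ((M i).V →ₗ[ℂ] N.V)) (hH : ∀ i, H i = homs (M i) N) :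
    Function.Bijective fun s : ∀ i, H i ⊗[ℂ] (M i).V => ∑ i, evalMaps (H i) (s i) := by
  obtain rfl : H = fun i => homs (M i) N := funext hH
  let L : (∀ i, homs (M i) N ⊗[ℂ] (M i).V) →ₗ[ℂ] N.V :=
    ∑ i, evalMaps (homs (M i) N) ∘ₗ LinearMap.proj i
  have hL : (fun s : ∀ i, homs (M i) N ⊗[ℂ] (M i).V => ∑ i, evalMaps (homs (M i) N) (s i)) = L := by
    ext s
    simp [L, LinearMap.sum_apply]
  rw [hL]
  have hdim : Module.finrank ℂ (∀ i, homs (M i) N ⊗[ℂ] (M i).V) = Module.finrank ℂ N.V := by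
    rw [Module.finrank_pi_fintype, ← sum_finrank_homs_mul hM N]
    simp only [Module.finrank_tensorProduct]
  have hsurj : Function.Surjective L := by
    rw [← LinearMap.range_eq_top, ← top_le_iff, ← span_homs hM N, Submodule.span_le]
    rintro _ ⟨i, f, hf, m, rfl⟩
    classical
    refine ⟨Pi.single i ((⟨f, hf⟩ : homs (M i) N) ⊗ₜ m), ?_⟩
    rw [← hL]
    refine (Finset.sum_eq_single i (fun j _ hj => ?_) (by simp)).trans ?_
    · rw [Pi.single_eq_of_ne hj, map_zero]
    · rw [Pi.single_eq_same]; rfl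
  exact ⟨(LinearMap.injective_iff_surjective_of_finrank_eq_finrank (K := ℂ)
    (V := ∀ i, homs (M i) N ⊗[ℂ] (M i).V) (V₂ := N.V) (f := L) hdim).2 hsurj, hsurj⟩

/-- The classes of the irreducible representations generate the monoid of classes. -/
theorem cls_mem_closure [Finite G] (hM : IsCompleteIrr M) (N : AlphaRep α) :
    N.cls ∈ AddSubmonoid.closure (Set.range fun i => (M i).cls) := by
  induction N using induction_on with
  | iso N N' φ h => rwa [← cls_eq_iff.2 ⟨φ⟩]
  | zero N h =>
    have : Subsingleton (zero α).V := inferInstanceAs (Subsingleton Unit)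
    have h1 : N.cls = 0 := cls_eq_iff.2 ⟨⟨LinearEquiv.ofLinearMap 0 0 (Subsingleton.elim _ _)
      (Subsingleton.elim _ _), fun _ _ => rfl⟩⟩
    rw [h1]
    exact zero_mem _
  | irr N h =>
    obtain ⟨j, hj⟩ := hM.2.2 N h
    rw [cls_eq_iff.2 hj]
    exact AddSubmonoid.subset_closure ⟨j, rfl⟩
  | sum N N' h h' => exact add_mem h h'

/-- A tensor in `F ⊗ V` is recovered from its contractions with the coordinates of a basis of
`F`. -/
theorem sum_basis_tmul_contraction {ι F V : Type} [Fintype ι] [AddCommGroup F] [Module ℂ F]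
    [AddCommGroup V] [Module ℂ V] (b : Module.Basis ι ℂ F) (t : F ⊗[ℂ] V) :
    ∑ k, b k ⊗ₜ[ℂ] TensorProduct.lid ℂ V ((b.coord k).rTensor V t) = t := by
  induction t using TensorProduct.induction_on with
  | zero => simp
  | tmul e v =>
    conv_rhs => rw [← b.sum_repr e, TensorProduct.sum_tmul]
    simp [TensorProduct.smul_tmul]
  | add s t hs ht =>
    conv_rhs => rw [← hs, ← ht]
    simp [TensorProduct.tmul_add, Finset.sum_add_distrib]

/-- Contracting `M → F ⊗ N` with a linear form on the multiplicity space `F` gives a homomorphism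
`M → N`. -/
theorem contraction_mem_homs {M N : AlphaRep α} {F : Type} [AddCommGroup F] [Module ℂ F]
    {f : M.V →ₗ[ℂ] F ⊗[ℂ] N.V}
    (hf : f ∈ intertwiners M.extAct fun γ => (N.extAct γ).lTensor F) (θ : Module.Dual ℂ F) :
    (TensorProduct.lid ℂ N.V).toLinearMap ∘ₗ θ.rTensor N.V ∘ₗ f ∈ homs M N := by
  intro γ v
  change TensorProduct.lid ℂ N.V (θ.rTensor N.V (f (M.extAct γ v))) =
    N.extAct γ (TensorProduct.lid ℂ N.V (θ.rTensor N.V (f v)))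
  rw [hf γ v]
  induction f v using TensorProduct.induction_on with
  | zero => simp
  | tmul e w => simp
  | add s t hs ht => simp only [map_add, hs, ht]

/-- There are no homomorphisms from an irreducible representation `M` to `F ⊗ N`, where `N` is
irreducible and not isomorphic to `M`. -/
theorem eq_zero_of_mem_intertwiners {M N : AlphaRep α} (hM : M.IsIrreducible)
    (hN : N.IsIrreducible) (hMN : ¬ Nonempty (Iso M N)) {F : Type} [AddCommGroup F] [Module ℂ F]
    [FiniteDimensional ℂ F] {f : M.V →ₗ[ℂ] F ⊗[ℂ] N.V}
    (hf : f ∈ intertwiners M.extAct fun γ => (N.extAct γ).lTensor F) : f = 0 := by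
  ext m
  rw [LinearMap.zero_apply, ← sum_basis_tmul_contraction (Module.finBasis ℂ F) (f m)]
  refine Finset.sum_eq_zero fun k _ => ?_
  have h := contraction_mem_homs hf ((Module.finBasis ℂ F).coord k)
  have h0 := not_not.1 fun h0 => hMN ⟨Iso.ofBijective _ h (bijective_of_ne_zero hM hN h h0)⟩
  have h1 := congrArg (fun L => L m) h0
  change TensorProduct.lid ℂ N.V (((Module.finBasis ℂ F).coord k).rTensor N.V (f m)) = 0 at h1
  rw [h1, TensorProduct.tmul_zero]

/-- The homomorphisms from an irreducible representation `M` to `F ⊗ M` are the maps `m ↦ e ⊗ m`. -/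
theorem exists_eq_tmul_of_mem_intertwiners {M : AlphaRep α} (hM : M.IsIrreducible) {F : Type}
    [AddCommGroup F] [Module ℂ F] [FiniteDimensional ℂ F] {f : M.V →ₗ[ℂ] F ⊗[ℂ] M.V}
    (hf : f ∈ intertwiners M.extAct fun γ => (M.extAct γ).lTensor F) :
    ∃ e : F, ∀ m, f m = e ⊗ₜ[ℂ] m := by
  let b := Module.finBasis ℂ F
  choose c hc using fun k => exists_eq_smul hM (contraction_mem_homs hf (b.coord k))
  refine ⟨∑ k, c k • b k, fun m => ?_⟩
  rw [← sum_basis_tmul_contraction b (f m), TensorProduct.sum_tmul]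
  refine Finset.sum_congr rfl fun k _ => ?_
  rw [TensorProduct.smul_tmul, ← hc k m]
  rfl

theorem eq_zero_of_forall_tmul_eq_zero {F V : Type} [AddCommGroup F] [Module ℂ F] [AddCommGroup V]
    [Module ℂ V] [Nontrivial V] {e : F} (h : ∀ v : V, e ⊗ₜ[ℂ] v = 0) : e = 0 := by
  obtain ⟨v, hv⟩ := exists_ne (0 : V)
  obtain ⟨θ, hθ⟩ : ∃ θ : Module.Dual ℂ V, θ v ≠ 0 := by
    by_contra! hc
    exact hv ((Module.forall_dual_apply_eq_zero_iff ℂ v).1 hc)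
  have h1 := CBundle.contr_tmul θ e v
  rw [h, map_zero] at h1
  exact (smul_eq_zero.1 h1.symm).resolve_left hθ

end AlphaRep
end Isotypic

/-! ### Bundle maps which are bijective on the fibres -/

section BundleMaps

variable {X : Type u} [TopologicalSpace X]

namespace CBundle

/-- In local trivializations the inverse of a fibrewise bijective bundle map is given by the inverses
of a continuous family of matrices, hence is continuous. -/
theorem continuous_symm_of_continuous {E E' : CBundle X} (φ : ∀ x, E.fiber x ≃ₗ[ℂ] E'.fiber x)
    (hφ : Continuous fun e : Tot E.fiber => (⟨e.base, φ e.base e.vec⟩ : Tot E'.fiber)) :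
    Continuous fun e : Tot E'.fiber => (⟨e.base, (φ e.base).symm e.vec⟩ : Tot E.fiber) := by
  refine continuous_of_local E'.continuous_base _ fun x₀ => ?_
  obtain ⟨U, n, hU, hx, ⟨T⟩⟩ := E.locally_trivial x₀
  obtain ⟨U', n', hU', hx', ⟨T'⟩⟩ := E'.locally_trivial x₀
  obtain rfl : n = n' := by
    have h := ((T.chart ⟨x₀, hx⟩).symm.trans ((φ x₀).trans (T'.chart ⟨x₀, hx'⟩))).finrank_eq
    simpa using h
  let S := T.restrict (U' := U ∩ U') Set.inter_subset_left
  let S' := T'.restrict (U' := U ∩ U') Set.inter_subset_right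
  let L : ↥(U ∩ U') → ((Fin n → ℂ) ≃ₗ[ℂ] (Fin n → ℂ)) := fun x =>
    (S.chart x).symm.trans ((φ x).trans (S'.chart x))
  let N : ↥(U ∩ U') → Matrix (Fin n) (Fin n) ℂ := fun x => LinearMap.toMatrix' (L x).toLinearMap
  have hN : Continuous N := by
    refine continuous_matrix fun i j => (continuous_apply i).comp ?_
    have h1 : Continuous fun x : ↥(U ∩ U') =>
        (⟨x, (S.chart x).symm (Pi.single j 1)⟩ : Tot E.fiber) :=
      S.continuous_symm.comp (continuous_id.prodMk continuous_const)
    exact S'.continuous_coord (hφ.comp h1) fun x => x.2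
  have hdet : ∀ x, (N x).det ≠ 0 := fun x => by
    rw [LinearMap.det_toMatrix']
    exact (L x).isUnit_det'.ne_zero
  have hinv : Continuous fun x => (N x)⁻¹ := by
    simp only [Matrix.inv_def, Ring.inverse_eq_inv']
    exact (hN.matrix_det.inv₀ hdet).smul hN.matrix_adjugate
  have hsymm : ∀ x w, (N x)⁻¹.mulVec w = (L x).symm w := fun x w => by
    have h1 : (N x).mulVec ((L x).symm w) = w := by
      rw [← Matrix.toLin'_apply, Matrix.toLin'_toMatrix']
      exact (L x).apply_symm_apply w
    conv_lhs => rw [← h1]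
    rw [Matrix.mulVec_mulVec, Matrix.nonsing_inv_mul _ (isUnit_iff_ne_zero.2 (hdet x)),
      Matrix.one_mulVec]
  refine ⟨U ∩ U', hU.inter hU', ⟨hx, hx'⟩, ?_⟩
  have hb : Continuous fun e : {e : Tot E'.fiber // e.base ∈ U ∩ U'} =>
      (⟨e.1.base, e.2⟩ : ↥(U ∩ U')) :=
    (E'.continuous_base.comp continuous_subtype_val).subtype_mk _
  refine (S.continuous_symm.comp (hb.prodMk
    ((hinv.comp hb).matrix_mulVec S'.continuous_chart))).congr fun e => ?_
  simp only [Function.comp_apply, hsymm]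
  simp [L]

theorem continuous_sum_sections (E : CBundle X) {Z : Type*} [TopologicalSpace Z] {f : Z → X}
    (hf : Continuous f) {ι : Type*} (I : Finset ι) {s : ι → ∀ z, E.fiber (f z)}
    (hs : ∀ i, Continuous fun z => (⟨f z, s i z⟩ : Tot E.fiber)) :
    Continuous fun z => (⟨f z, ∑ i ∈ I, s i z⟩ : Tot E.fiber) := by
  classical
  induction I using Finset.induction_on with
  | empty => simpa [Function.comp_def] using E.continuous_zero.comp hf
  | insert i I hi h => simpa only [Finset.sum_insert hi] using E.continuous_add (hs i) h

/-- A bundle map which is bijective on the fibres is an isomorphism. -/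
noncomputable def Iso.ofBijective {E E' : CBundle X} (φ : ∀ x, E.fiber x →ₗ[ℂ] E'.fiber x)
    (hφ : Continuous fun e : Tot E.fiber => (⟨e.base, φ e.base e.vec⟩ : Tot E'.fiber))
    (hb : ∀ x, Function.Bijective (φ x)) : Iso E E' where
  toEquiv x := LinearEquiv.ofBijective (φ x) (hb x)
  continuous_toFun := hφ
  continuous_invFun :=
    continuous_symm_of_continuous (fun x => LinearEquiv.ofBijective (φ x) (hb x)) hφ

/-- The isomorphism class of a vector bundle. -/
def cls (E : CBundle X) : VectClass X := Quotient.mk (CBundle.setoid X) E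

theorem cls_eq {E E' : CBundle X} (φ : Iso E E') : E.cls = E'.cls := Quotient.sound ⟨φ⟩

theorem cls_eq_zero (E : CBundle X) (h : ∀ x, Subsingleton (E.fiber x)) : E.cls = 0 :=
  cls_eq <| Iso.ofBijective (E' := zero X) (fun _ => 0)
    ((zero X).continuous_zero.comp E.continuous_base)
    fun _ => ⟨fun _ _ _ => Subsingleton.elim _ _, fun _ => ⟨0, rfl⟩⟩

end CBundle

variable {G : Type v} [Group G] {α : Cocycle G} [MulAction G X]

namespace TwistedBundle

/-- The isomorphism class of a twisted bundle. -/
def cls (E : TwistedBundle α X) : TwClass X α := Quotient.mk (TwistedBundle.setoid α X) E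

theorem cls_eq {E E' : TwistedBundle α X} (φ : Iso E E') : E.cls = E'.cls := Quotient.sound ⟨φ⟩

variable (triv : ∀ (g : G) (x : X), g • x = x)

/-- A fibrewise bijective map of twisted bundles over a trivial `G`-space which is equivariant on the
fibres is an isomorphism. -/
noncomputable def Iso.ofBijective {E E' : TwistedBundle α X} (φ : ∀ x, E.fiber x →ₗ[ℂ] E'.fiber x)
    (hφ : Continuous fun e : Tot E.fiber => (⟨e.base, φ e.base e.vec⟩ : Tot E'.fiber))
    (hb : ∀ x, Function.Bijective (φ x))
    (he : ∀ γ x v, φ x (E.fiberAct triv γ x v) = E'.fiberAct triv γ x (φ x v)) : Iso E E' where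
  toIso := CBundle.Iso.ofBijective φ hφ hb
  equivariant γ x v := by
    apply (E'.castFiber (triv γ.proj x)).injective
    refine (CBundle.Iso.map_castFiber (CBundle.Iso.ofBijective φ hφ hb) (triv γ.proj x)
      (E.act γ x v)).symm.trans ?_
    exact he γ x v

theorem Iso.map_fiberAct {E E' : TwistedBundle α X} (φ : Iso E E') (γ : Ext α) (x : X)
    (v : E.fiber x) :
    φ.toEquiv x (E.fiberAct triv γ x v) = E'.fiberAct triv γ x (φ.toEquiv x v) :=
  (φ.toIso.map_castFiber (triv γ.proj x) _).trans
    (congrArg (E'.castFiber (triv γ.proj x)) (φ.equivariant γ x v))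

theorem fiberAct_sum (E E' : TwistedBundle α X) (γ : Ext α) (x : X) (v : (E.sum E').fiber x) :
    (E.sum E').fiberAct triv γ x v = (E.fiberAct triv γ x v.1, E'.fiberAct triv γ x v.2) :=
  CBundle.castFiber_sum E.toCBundle E'.toCBundle (triv γ.proj x) _

theorem fiberAct_tensorTwisted (E : CBundle X) (M : AlphaRep α) (γ : Ext α) (x : X) :
    (tensorTwisted triv E M).fiberAct triv γ x = (M.extAct γ).lTensor (E.fiber x) := by
  ext1 t
  exact CBundle.mk_inj _ (((tensorTwisted triv E M).mk_fiberAct triv γ x t).trans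
    (E.mk_map_castFiber _ _ _ _))

/-- A finite family of twisted bundles has a direct sum. -/
theorem exists_finite_sum [ContinuousConstSMul G X] {n : ℕ} (F : Fin n → TwistedBundle α X) :
    ∃ (S : TwistedBundle α X) (e : ∀ x, S.fiber x ≃ₗ[ℂ] ∀ i, (F i).fiber x),
      S.cls = ∑ i, (F i).cls ∧
      (∀ i, Continuous fun t : Tot S.fiber => (⟨t.base, e t.base t.vec i⟩ : Tot (F i).fiber)) ∧
      ∀ γ x v i, e x (S.fiberAct triv γ x v) i = (F i).fiberAct triv γ x (e x v i) := by
  induction n with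
  | zero =>
    have : ∀ x, Subsingleton ((zero α X).fiber x) := fun x => inferInstanceAs (Subsingleton Unit)
    exact ⟨zero α X, fun x => LinearEquiv.ofLinearMap 0 0 (Subsingleton.elim _ _)
      (Subsingleton.elim _ _), by simp; rfl, fun i => i.elim0, fun _ _ _ i => i.elim0⟩
  | succ n ih =>
    obtain ⟨S, e, hcls, hcont, hact⟩ := ih fun i => F i.succ
    refine ⟨(F 0).sum S, fun x => ((LinearEquiv.refl ℂ _).prodCongr (e x)).trans
      (Fin.consLinearEquiv ℂ fun i => (F i).fiber x), ?_, ?_, ?_⟩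
    · rw [Fin.sum_univ_succ, ← hcls]
      rfl
    · intro i
      refine Fin.cases ?_ (fun i => ?_) i
      · exact CBundle.continuous_sum_fst continuous_id
      · exact (hcont i).comp
          (CBundle.continuous_sum_snd (E := (F 0).toCBundle) (E' := S.toCBundle) continuous_id)
    · intro γ x v i
      rw [fiberAct_sum]
      refine Fin.cases ?_ (fun i => ?_) i
      · rfl
      · exact hact γ x v.2 i

end TwistedBundle

end BundleMaps

/-! ### The bundles of equivariant homomorphisms -/

section HomBundles

variable {X : Type u} [TopologicalSpace X] {G : Type v} [Group G] {α : Cocycle G} [MulAction G X]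
  (triv : ∀ (g : G) (x : X), g • x = x)

namespace TwistedBundle

section Functor

variable [Finite G] (M : AlphaRep α)

theorem continuous_homBundle_iff (E : TwistedBundle α X) {Z : Type*} [TopologicalSpace Z]
    {F : Z → Tot (E.homBundle triv M).fiber} :
    Continuous F ↔ (Continuous fun z => (F z).base) ∧ ∀ m : M.V,
      Continuous fun z => (⟨(F z).base, (F z).vec.1 m⟩ : Tot E.fiber) :=
  E.continuous_hom_iff triv M

/-- `Hom(M, E)` is functorial for isomorphisms in `E`. -/
def homBundleCongr {E E' : TwistedBundle α X} (φ : E.Iso E') :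
    (E.homBundle triv M).Iso (E'.homBundle triv M) where
  toEquiv x :=
    { toFun := fun f => ⟨(φ.toEquiv x).toLinearMap ∘ₗ f.1, fun γ m =>
        (congrArg (φ.toEquiv x) (f.2 γ m)).trans (φ.map_fiberAct triv γ x _)⟩
      invFun := fun f => ⟨(φ.symm.toEquiv x).toLinearMap ∘ₗ f.1, fun γ m =>
        (congrArg (φ.symm.toEquiv x) (f.2 γ m)).trans (φ.symm.map_fiberAct triv γ x _)⟩
      map_add' := fun _ _ => Subtype.ext (LinearMap.comp_add _ _ _)
      map_smul' := fun _ _ => Subtype.ext (LinearMap.comp_smul _ _ _)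
      left_inv := fun f => Subtype.ext <| LinearMap.ext fun m =>
        (φ.toEquiv x).symm_apply_apply (f.1 m)
      right_inv := fun f => Subtype.ext <| LinearMap.ext fun m =>
        (φ.toEquiv x).apply_symm_apply (f.1 m) }
  continuous_toFun := by
    have hc := (continuous_homBundle_iff triv M E).1 continuous_id
    exact (continuous_homBundle_iff triv M E').2 ⟨hc.1, fun m => φ.continuous_map (hc.2 m)⟩
  continuous_invFun := by
    have hc := (continuous_homBundle_iff triv M E').1 continuous_id
    exact (continuous_homBundle_iff triv M E).2 ⟨hc.1, fun m => φ.symm.continuous_map (hc.2 m)⟩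

/-- `Hom(M, E ⊕ E') ≅ Hom(M, E) ⊕ Hom(M, E')`. -/
def homBundleSum (E E' : TwistedBundle α X) :
    ((E.sum E').homBundle triv M).Iso ((E.homBundle triv M).sum (E'.homBundle triv M)) where
  toEquiv x :=
    { toFun := fun f =>
        (⟨LinearMap.fst ℂ _ _ ∘ₗ f.1, fun γ m =>
          congrArg Prod.fst ((f.2 γ m).trans (fiberAct_sum triv E E' γ x _))⟩,
          ⟨LinearMap.snd ℂ _ _ ∘ₗ f.1, fun γ m =>
            congrArg Prod.snd ((f.2 γ m).trans (fiberAct_sum triv E E' γ x _))⟩)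
      invFun := fun f => ⟨f.1.1.prod f.2.1, fun γ m =>
        (Prod.ext (f.1.2 γ m) (f.2.2 γ m)).trans (fiberAct_sum triv E E' γ x _).symm⟩
      map_add' := fun _ _ => rfl
      map_smul' := fun _ _ => rfl
      left_inv := fun _ => rfl
      right_inv := fun _ => rfl }
  continuous_toFun := by
    have hc := (continuous_homBundle_iff triv M (E.sum E')).1 continuous_id
    refine (CBundle.continuous_sum_iff _ _).2
      ⟨(continuous_homBundle_iff triv M E).2 ⟨hc.1, fun m => ?_⟩,
        (continuous_homBundle_iff triv M E').2 ⟨hc.1, fun m => ?_⟩⟩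
    · exact CBundle.continuous_sum_fst (hc.2 m)
    · exact CBundle.continuous_sum_snd (hc.2 m)
  continuous_invFun := by
    have hc := (CBundle.continuous_sum_iff (E.homBundle triv M) (E'.homBundle triv M)).1
      (continuous_id (X := Tot ((E.homBundle triv M).sum (E'.homBundle triv M)).fiber))
    have h1 := (continuous_homBundle_iff triv M E).1 hc.1
    have h2 := (continuous_homBundle_iff triv M E').1 hc.2
    exact (continuous_homBundle_iff triv M (E.sum E')).2
      ⟨h1.1, fun m => CBundle.continuous_sum_mk (h1.2 m) (h2.2 m)⟩

/-- The homomorphism of monoids of isomorphism classes `[E] ↦ [Hom(M, E)]`. -/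
def homClass [ContinuousConstSMul G X] : TwClass X α →+ VectClass X where
  toFun := Quotient.map (fun E => E.homBundle triv M) fun _ _ ⟨φ⟩ => ⟨homBundleCongr triv M φ⟩
  map_zero' := CBundle.cls_eq_zero ((zero α X).homBundle triv M) fun _ =>
    ⟨fun f f' => Subtype.ext (LinearMap.ext fun m =>
      Subsingleton.elim (α := Unit) (f.1 m) (f'.1 m))⟩
  map_add' := by
    rintro ⟨E⟩ ⟨E'⟩
    exact CBundle.cls_eq (homBundleSum triv M E E')

end Functor

/-! ### The isotypic decomposition of a twisted bundle -/

/-- Over a trivial `G`-space, the fibres of a twisted bundle are `α`-representations. -/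
noncomputable def fiberRep (E : TwistedBundle α X) (x : X) : AlphaRep α :=
  have := E.finiteDimensional_fiber x
  AlphaRep.ofEnd (E.fiber x) (fun g => E.fiberAct triv ⟨g, 1⟩ x)
    (fun v => congrArg (fun L => L v) (E.fiberAct_one triv x))
    (fun g h v => by
      have h1 : (⟨g, 1⟩ * ⟨h, 1⟩ : Ext α) = ⟨1, α.toFun g h⟩ * ⟨g * h, 1⟩ := by
        ext1 <;> simp [α.one_left]
      have h2 := E.fiberAct_mul triv ⟨g, 1⟩ ⟨h, 1⟩ x
      rw [h1, E.fiberAct_mul, E.fiberAct_circle] at h2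
      exact (congrArg (fun L => L v) h2).symm)

/-- The action of the extension on a fibre is that of the representation `fiberRep`, because the
central circle acts by scalars on both. -/
theorem homFiber_eq_homs (E : TwistedBundle α X) (M : AlphaRep α) (x : X) :
    E.homFiber triv M x = AlphaRep.homs M (E.fiberRep triv x) := by
  have h : ∀ γ, E.fiberAct triv γ x = (E.fiberRep triv x).extAct γ := fun γ => by
    have h1 : γ = ⟨1, γ.phase⟩ * ⟨γ.proj, 1⟩ := by
      ext1 <;> simp [α.one_left]
    conv_lhs => rw [h1, E.fiberAct_mul, E.fiberAct_circle]
    rfl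
  exact congrArg (intertwiners M.extAct) (funext h)

/-- Evaluation `Hom(M, E) ⊗ M → E` is continuous on total spaces: in a basis of `M` it is a sum of
contractions followed by evaluations at the basis vectors. -/
theorem continuous_evalMaps [Finite G] (E : TwistedBundle α X) (M : AlphaRep α) :
    Continuous fun t : Tot ((E.homBundle triv M).tensor M.V).fiber =>
      (⟨t.base, AlphaRep.evalMaps (E.homFiber triv M t.base) t.vec⟩ : Tot E.fiber) := by
  have hc := (CBundle.continuous_tensor_iff (E.homBundle triv M) M.V).1 continuous_id
  let b := Module.finBasis ℂ M.V
  refine (E.continuous_sum_sections hc.1 Finset.univ fun k =>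
    ((continuous_homBundle_iff triv M E).1 (hc.2 (b.coord k))).2 (b k)).congr fun t => ?_
  exact congrArg (fun v => (⟨t.base, v⟩ : Tot E.fiber)) (AlphaRep.evalMaps_eq_sum b _ t.vec).symm

theorem evalMaps_lTensor (E : TwistedBundle α X) (M : AlphaRep α) (γ : Ext α) (x : X)
    (t : E.homFiber triv M x ⊗[ℂ] M.V) :
    AlphaRep.evalMaps (E.homFiber triv M x) ((M.extAct γ).lTensor _ t) =
      E.fiberAct triv γ x (AlphaRep.evalMaps (E.homFiber triv M x) t) := by
  induction t using TensorProduct.induction_on with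
  | zero => simp
  | tmul f m => exact f.2 γ m
  | add s t hs ht => simp only [map_add, hs, ht]

variable {n : ℕ} {M : Fin n → AlphaRep α}

/-- A twisted bundle over a trivial `G`-space is the direct sum of its isotypic parts
`Hom(M i, E) ⊗ M i`. -/
theorem cls_eq_sum_tensorClass [Finite G] [ContinuousConstSMul G X]
    (hM : AlphaRep.IsCompleteIrr M) (E : TwistedBundle α X) :
    E.cls = ∑ i, tensorClass triv α (E.homBundle triv (M i)).cls (M i).cls := by
  obtain ⟨S, e, hcls, hcont, hact⟩ := exists_finite_sum triv fun i =>
    tensorTwisted triv (E.homBundle triv (M i)) (M i)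
  refine Eq.trans ?_ hcls
  let ev : ∀ x i, E.homFiber triv (M i) x ⊗[ℂ] (M i).V →ₗ[ℂ] E.fiber x := fun x i =>
    AlphaRep.evalMaps (E.homFiber triv (M i) x)
  let φ : ∀ x, S.fiber x →ₗ[ℂ] E.fiber x := fun x =>
    ∑ i, ev x i ∘ₗ LinearMap.proj i ∘ₗ (e x).toLinearMap
  have hφ : ∀ x v, φ x v = ∑ i, ev x i (e x v i) := fun x v => by
    simp only [φ, LinearMap.sum_apply]
    rfl
  refine (cls_eq (Iso.ofBijective triv φ ?_ (fun x => ?_) fun γ x v => ?_)).symm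
  · simp only [hφ]
    exact E.continuous_sum_sections S.continuous_base Finset.univ fun i =>
      (continuous_evalMaps triv E (M i)).comp (hcont i)
  · rw [show ⇑(φ x) = fun v => ∑ i, ev x i (e x v i) from funext (hφ x)]
    exact (AlphaRep.bijective_sum_evalMaps hM (E.fiberRep triv x)
      (fun i => E.homFiber triv (M i) x) fun i => homFiber_eq_homs triv E (M i) x).comp
        (e x).bijective
  · rw [hφ, hφ, map_sum]
    refine Finset.sum_congr rfl fun i _ => ?_
    rw [hact, fiberAct_tensorTwisted]
    exact evalMaps_lTensor triv E (M i) γ x _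

/-! ### Schur's lemma for bundles -/

theorem homFiber_tensorTwisted (E : CBundle X) (M N : AlphaRep α) (x : X) :
    (tensorTwisted triv E N).homFiber triv M x =
      intertwiners M.extAct fun γ => (N.extAct γ).lTensor (E.fiber x) :=
  congrArg (intertwiners M.extAct) (funext fun γ => fiberAct_tensorTwisted triv E N γ x)

/-- `Hom(M, E ⊗ N) = 0` for irreducible `M` and `N` which are not isomorphic. -/
theorem homBundle_tensorTwisted_of_not_iso [Finite G] {M N : AlphaRep α} (hM : M.IsIrreducible)
    (hN : N.IsIrreducible) (hMN : ¬ Nonempty (M.Iso N)) (E : CBundle X) :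
    ((tensorTwisted triv E N).homBundle triv M).cls = 0 := by
  refine CBundle.cls_eq_zero _ fun x => ?_
  have := E.finiteDimensional_fiber x
  have h : ∀ f : (tensorTwisted triv E N).homFiber triv M x, f.1 = 0 := fun f => by
    exact AlphaRep.eq_zero_of_mem_intertwiners hM hN hMN
      ((homFiber_tensorTwisted triv E M N x).le f.2)
  exact ⟨fun f f' => Subtype.ext ((h f).trans (h f').symm)⟩

/-- `Hom(M, E ⊗ M) ≅ E` for irreducible `M`: by Schur's lemma the coevaluation `e ↦ (m ↦ e ⊗ m)` is
bijective on the fibres. -/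
theorem homBundle_tensorTwisted_self [Finite G] {M : AlphaRep α} (hM : M.IsIrreducible)
    (E : CBundle X) : ((tensorTwisted triv E M).homBundle triv M).cls = E.cls := by
  have hmem : ∀ x (e : E.fiber x), TensorProduct.mk ℂ (E.fiber x) M.V e ∈
      (tensorTwisted triv E M).homFiber triv M x := fun x e => by
    rw [homFiber_tensorTwisted]
    exact fun _ _ => rfl
  let φ : ∀ x, E.fiber x →ₗ[ℂ] (tensorTwisted triv E M).homFiber triv M x := fun x =>
    (TensorProduct.mk ℂ (E.fiber x) M.V).codRestrict _ (hmem x)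
  refine (CBundle.cls_eq (CBundle.Iso.ofBijective (E' := (tensorTwisted triv E M).homBundle triv M)
    φ ?_ fun x => ⟨?_, fun f => ?_⟩)).symm
  · refine (continuous_homBundle_iff triv M _).2 ⟨E.continuous_base, fun m => ?_⟩
    refine (CBundle.continuous_tensor_iff E M.V).2 ⟨E.continuous_base, fun θ => ?_⟩
    refine (E.continuous_smul (continuous_const (y := θ m)) continuous_id).congr fun e => ?_
    exact congrArg (fun v => (⟨e.base, v⟩ : Tot E.fiber)) (CBundle.contr_tmul θ e.vec m).symm
  · refine (injective_iff_map_eq_zero (φ x)).2 fun e he => ?_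
    have := hM.1
    exact AlphaRep.eq_zero_of_forall_tmul_eq_zero fun m =>
      congrArg (fun f : (tensorTwisted triv E M).homFiber triv M x => f.1 m) he
  · have := E.finiteDimensional_fiber x
    obtain ⟨e, he⟩ := AlphaRep.exists_eq_tmul_of_mem_intertwiners hM
      ((homFiber_tensorTwisted triv E M M x).le f.2)
    exact ⟨e, Subtype.ext (LinearMap.ext fun m => (he m).symm)⟩

end TwistedBundle

end HomBundles

/-! ### The inverse of the comparison map -/

section Inverse

open Algebra (GrothendieckAddGroup)

theorem grothendieckHom_ext {A B : Type*} [AddCommMonoid A] [AddCommGroup B]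
    {φ ψ : GrothendieckAddGroup A →+ B}
    (h : ∀ a, φ (GrothendieckAddGroup.of a) = ψ (GrothendieckAddGroup.of a)) : φ = ψ :=
  GrothendieckAddGroup.lift.symm.injective (DFunLike.ext _ _ h)

/-- A homomorphism on a tensor product of Grothendieck groups is determined by its values on the
tensors of generators. -/
theorem grothendieckTensorHom_ext {A B C : Type*} [AddCommMonoid A] [AddCommMonoid B]
    [AddCommGroup C] {φ ψ : GrothendieckAddGroup A ⊗[ℤ] GrothendieckAddGroup B →+ C}
    (h : ∀ a b, φ (GrothendieckAddGroup.of a ⊗ₜ GrothendieckAddGroup.of b) =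
      ψ (GrothendieckAddGroup.of a ⊗ₜ GrothendieckAddGroup.of b)) : φ = ψ := by
  have h1 : ∀ a y, φ (GrothendieckAddGroup.of a ⊗ₜ y) = ψ (GrothendieckAddGroup.of a ⊗ₜ y) := by
    intro a
    exact DFunLike.congr_fun (grothendieckHom_ext
      (φ := φ.comp (TensorProduct.mk ℤ _ _ (GrothendieckAddGroup.of a)).toAddMonoidHom)
      (ψ := ψ.comp (TensorProduct.mk ℤ _ _ (GrothendieckAddGroup.of a)).toAddMonoidHom) (h a))
  have h2 : ∀ y x, φ (x ⊗ₜ y) = ψ (x ⊗ₜ y) := by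
    intro y
    exact DFunLike.congr_fun (grothendieckHom_ext
      (φ := φ.comp ((TensorProduct.mk ℤ _ _).flip y).toAddMonoidHom)
      (ψ := ψ.comp ((TensorProduct.mk ℤ _ _).flip y).toAddMonoidHom) fun a => h1 a y)
  ext t
  induction t using TensorProduct.induction_on with
  | zero => rw [map_zero, map_zero]
  | tmul x y => exact h2 y x
  | add s t hs ht => rw [map_add, map_add, hs, ht]

variable {X : Type u} [TopologicalSpace X] {G : Type v} [Group G] [Finite G] {α : Cocycle G}
  [MulAction G X] [ContinuousConstSMul G X] (triv : ∀ (g : G) (x : X), g • x = x)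
  {n : ℕ} {M : Fin n → AlphaRep α}

/-- The map `[E] ↦ ∑ i, [Hom(M i, E)] ⊗ [M i]`. -/
noncomputable def isotypicMap (M : Fin n → AlphaRep α) :
    TwistedKGroup X α →+ KGroup X ⊗[ℤ] RGroup α :=
  ∑ i, ((TensorProduct.mk ℤ (KGroup X) (RGroup α)).flip (M i).toR).toAddMonoidHom.comp
    (grothendieckMap (TwistedBundle.homClass triv (M i)))

theorem isotypicMap_toK (M : Fin n → AlphaRep α) (E : TwistedBundle α X) :
    isotypicMap triv M E.toK = ∑ i, (E.homBundle triv (M i)).toK ⊗ₜ[ℤ] (M i).toR := by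
  rw [isotypicMap, AddMonoidHom.finsetSum_apply]
  refine Finset.sum_congr rfl fun i _ => ?_
  exact congrArg (fun c : KGroup X => c ⊗ₜ[ℤ] (M i).toR)
    (grothendieckMap_of (TwistedBundle.homClass triv (M i)) E.cls)

/-- The isotypic decomposition of twisted bundles gives a right inverse of the comparison map. -/
theorem tensorMap_isotypicMap (hM : AlphaRep.IsCompleteIrr M) (t : TwistedKGroup X α) :
    tensorMap triv α (isotypicMap triv M t) = t := by
  refine DFunLike.congr_fun (grothendieckHom_ext
    (φ := (tensorMap triv α).comp (isotypicMap triv M)) (ψ := AddMonoidHom.id _) ?_) t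
  rintro ⟨E⟩
  change tensorMap triv α (isotypicMap triv M E.toK) = E.toK
  rw [isotypicMap_toK, map_sum]
  have h := congrArg (GrothendieckAddGroup.of (M := TwClass X α))
    (TwistedBundle.cls_eq_sum_tensorClass triv hM E)
  rw [map_sum] at h
  refine Eq.trans (Finset.sum_congr rfl fun i _ => ?_) h.symm
  exact tensorMap_tmul triv _ _

/-- Schur's lemma gives a left inverse of the comparison map. -/
theorem isotypicMap_tensorMap (hM : AlphaRep.IsCompleteIrr M) (t : KGroup X ⊗[ℤ] RGroup α) :
    isotypicMap triv M (tensorMap triv α t) = t := by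
  refine DFunLike.congr_fun (grothendieckTensorHom_ext
    (φ := (isotypicMap triv M).comp (tensorMap triv α)) (ψ := AddMonoidHom.id _) ?_) t
  rintro ⟨E⟩ d
  let ι := (TensorProduct.mk ℤ (KGroup X) (RGroup α) E.toK).toAddMonoidHom.comp
    (GrothendieckAddGroup.of (M := RepClass α))
  -- both sides are additive in the representation, so it may be assumed to be one of the `M j`
  have hd : d ∈ AddSubmonoid.closure (Set.range fun i => (M i).cls) := by
    obtain ⟨N⟩ := d
    exact AlphaRep.cls_mem_closure hM N
  have h : Set.EqOn (((isotypicMap triv M).comp (tensorMap triv α)).comp ι) ι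
      (AddSubmonoid.closure (Set.range fun i => (M i).cls)) := by
    refine AddMonoidHom.eqOn_closureM ?_
    rintro _ ⟨j, rfl⟩
    change isotypicMap triv M (tensorMap triv α (E.toK ⊗ₜ (M j).toR)) = E.toK ⊗ₜ (M j).toR
    rw [tensorMap_tmul, isotypicMap_toK, Finset.sum_eq_single j (fun i _ hij => ?_) (by simp)]
    · exact congrArg (fun c => GrothendieckAddGroup.of (M := VectClass X) c ⊗ₜ[ℤ] (M j).toR)
        (TwistedBundle.homBundle_tensorTwisted_self triv (hM.1 j) E)
    · have h0 : ((tensorTwisted triv E (M j)).homBundle triv (M i)).toK = 0 :=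
        (congrArg (GrothendieckAddGroup.of (M := VectClass X))
          (TwistedBundle.homBundle_tensorTwisted_of_not_iso triv (hM.1 i) (hM.1 j)
            (fun h => hij (hM.2.1 i j h)) E)).trans (map_zero _)
      rw [h0, TensorProduct.zero_tmul]
  exact h hd

end Inverse

/-! ### Naturality -/

section Naturality

open Algebra (GrothendieckAddGroup)

variable {X : Type u} [TopologicalSpace X] {G : Type v} [Group G] {α : Cocycle G}
  [MulAction G X] (triv : ∀ (g : G) (x : X), g • x = x)
  {H : Type*} [Group H] (h : H →* G) {Y : Type*} [TopologicalSpace Y]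
  [MulAction H Y] [ContinuousConstSMul H Y] (trivY : ∀ (k : H) (y : Y), k • y = y)
  (f : C(Y, X)) (hf : ∀ (k : H) (y : Y), f (k • y) = h k • f y)

theorem CBundle.castFiber_pullback (E : CBundle X) {y y' : Y} (hy : y = y') (v : E.fiber (f y)) :
    (E.pullback f).castFiber hy v = E.castFiber (congrArg f hy) v := by
  subst hy; rfl

theorem CBundle.castFiber_trans (E : CBundle X) {x y z : X} (hxy : x = y) (hyz : y = z)
    (v : E.fiber x) : E.castFiber hyz (E.castFiber hxy v) = E.castFiber (hxy.trans hyz) v := by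
  subst hxy; rfl

theorem TwistedBundle.fiberAct_pullback (E : TwistedBundle α X) (γ : Ext (α.comap h)) (y : Y)
    (v : E.fiber (f y)) :
    (E.pullback h f hf).fiberAct trivY γ y v = E.fiberAct triv (Ext.map h γ) (f y) v :=
  (E.toCBundle.castFiber_pullback f _ _).trans (E.toCBundle.castFiber_trans _ _ _)

variable [ContinuousConstSMul G X]

/-- `f^* E ⊗ h^* M` is the pullback of `E ⊗ M`. -/
noncomputable def pullbackTensorTwisted (E : CBundle X) (M : AlphaRep α) :
    (tensorTwisted trivY (E.pullback f) (M.comap h)).Iso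
      ((tensorTwisted triv E M).pullback h f hf) :=
  TwistedBundle.Iso.ofBijective trivY (fun _ => LinearMap.id)
    (by
      have hc := (CBundle.continuous_tensor_iff (E.pullback f) M.V).1 continuous_id
      refine (CBundle.continuous_pullback_iff (E.tensor M.V) f).2 ⟨hc.1, ?_⟩
      exact (CBundle.continuous_tensor_iff E M.V).2 ⟨f.continuous.comp hc.1, fun θ =>
        ((CBundle.continuous_pullback_iff E f).1 (hc.2 θ)).2⟩)
    (fun _ => Function.bijective_id)
    (fun γ y v => by
      have h1 := congrArg (fun L => L v)
        (TwistedBundle.fiberAct_tensorTwisted trivY (E.pullback f) (M.comap h) γ y)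
      have h2 := congrArg (fun L => L v)
        (TwistedBundle.fiberAct_tensorTwisted triv E M (Ext.map h γ) (f y))
      exact (h1.trans h2.symm).trans (TwistedBundle.fiberAct_pullback triv h trivY f hf
        (tensorTwisted triv E M) γ y v).symm)

theorem tensorMap_natural (t : KGroup X ⊗[ℤ] RGroup α) :
    tensorMap trivY (α.comap h) (TensorProduct.map (KGroup.pullback f).toIntLinearMap
      (RGroup.comap h).toIntLinearMap t) =
      TwistedKGroup.pullback h f hf (tensorMap triv α t) := by
  refine DFunLike.congr_fun (grothendieckTensorHom_ext
    (φ := (tensorMap trivY (α.comap h)).comp (TensorProduct.map (KGroup.pullback f).toIntLinearMap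
      (RGroup.comap h).toIntLinearMap).toAddMonoidHom)
    (ψ := (TwistedKGroup.pullback h f hf).comp (tensorMap triv α)) ?_) t
  rintro ⟨E⟩ ⟨M⟩
  change tensorMap trivY (α.comap h) (KGroup.pullback f E.toK ⊗ₜ RGroup.comap h M.toR) =
    TwistedKGroup.pullback h f hf (tensorMap triv α (E.toK ⊗ₜ M.toR))
  have h1 : KGroup.pullback f E.toK = (E.pullback f).toK := grothendieckMap_of _ _
  have h2 : RGroup.comap h M.toR = (M.comap h).toR := grothendieckMap_of _ _
  have h3 : TwistedKGroup.pullback h f hf (tensorTwisted triv E M).toK =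
    ((tensorTwisted triv E M).pullback h f hf).toK := grothendieckMap_of _ _
  rw [h1, h2, tensorMap_tmul, tensorMap_tmul, h3]
  exact congrArg (GrothendieckAddGroup.of (M := TwClass Y (α.comap h)))
    (TwistedBundle.cls_eq (pullbackTensorTwisted triv h trivY f hf E M))

end Naturality

end TwistedK

theorem mainTheorem11 {G : Type*} [Group G] [Finite G] (α : TwistedK.Cocycle G)
    {X : Type*} [TopologicalSpace X] [MulAction G X] [ContinuousConstSMul G X]
    (triv : ∀ (g : G) (x : X), g • x = x) :
    -- the natural map `[E] ⊗ [M] ↦ [E ⊗ M]` is an isomorphism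
    ∃ Φ : TensorProduct ℤ (TwistedK.KGroup X) (TwistedK.RGroup α) ≃+ TwistedK.TwistedKGroup X α,
      (∀ t, Φ t = TwistedK.tensorMap triv α t) ∧
      (∀ (E : TwistedK.CBundle X) (M : TwistedK.AlphaRep α),
        Φ (E.toK ⊗ₜ[ℤ] M.toR) = (TwistedK.tensorTwisted triv E M).toK) ∧
      -- there are finitely many irreducible `α`-representations, and the inverse of the map is the
      -- isotypic decomposition
      (∃ (n : ℕ) (M : Fin n → TwistedK.AlphaRep α), TwistedK.AlphaRep.IsCompleteIrr M) ∧
      (∀ (n : ℕ) (M : Fin n → TwistedK.AlphaRep α), TwistedK.AlphaRep.IsCompleteIrr M →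
        ∀ E : TwistedK.TwistedBundle α X,
          Φ.symm E.toK = ∑ i, (E.homBundle triv (M i)).toK ⊗ₜ[ℤ] (M i).toR) ∧
      -- the map is natural in the space and in the group
      (∀ {H : Type*} [Group H] [Finite H] (h : H →* G) {Y : Type*} [TopologicalSpace Y]
        [MulAction H Y] [ContinuousConstSMul H Y] (trivY : ∀ (k : H) (y : Y), k • y = y)
        (f : C(Y, X)) (hf : ∀ (k : H) (y : Y), f (k • y) = h k • f y)
        (t : TensorProduct ℤ (TwistedK.KGroup X) (TwistedK.RGroup α)),
        TwistedK.tensorMap trivY (α.comap h)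
            (TensorProduct.map (TwistedK.KGroup.pullback f).toIntLinearMap
              (TwistedK.RGroup.comap h).toIntLinearMap t) =
          TwistedK.TwistedKGroup.pullback h f hf (Φ t)) := by 
  obtain ⟨n, M, hM⟩ := TwistedK.AlphaRep.exists_isCompleteIrr α
  let Φ : TensorProduct ℤ (TwistedK.KGroup X) (TwistedK.RGroup α) ≃+ TwistedK.TwistedKGroup X α :=
    { toFun := TwistedK.tensorMap triv α
      invFun := TwistedK.isotypicMap triv M
      left_inv := TwistedK.isotypicMap_tensorMap triv hM
      right_inv := TwistedK.tensorMap_isotypicMap triv hM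
      map_add' := map_add _ }
  refine ⟨Φ, fun _ => rfl, fun E N => TwistedK.tensorMap_tmul triv E N, ⟨n, M, hM⟩,
    fun m N hN E => ?_, fun h _ _ _ _ trivY f hf t =>
      TwistedK.tensorMap_natural triv h trivY f hf t⟩
  rw [AddEquiv.symm_apply_eq, ← TwistedK.isotypicMap_toK]
  exact (TwistedK.tensorMap_isotypicMap triv hN E.toK).symm
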